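/- Let $p$ be a prime, $q_0=p^e$ with $e\ge 1$, let $m,s,\ell\ge 1$ be integers, $q=q_0^s$ and $\mathbb F=\mathbb F_{q_0^m}\subseteq\mathbb F_{q^m}\supseteq\mathbb F_q$. Assume that $p\nmid \ell$ and that $\mathbb F_q$ contains all roots of $x^\ell-1$. Let $\sigma$ be the map $a\mapsto a^q$ on $\mathbb F$ and on $\mathbb F_{q^m}$. Put $\mathcal S=\mathbb F[x]/(x^\ell-1)$, extend $\sigma$ to $\mathcal S$ by $\sigma(x)=x$, let $\mathcal S[z;\sigma]$ be the skew polynomial ring with $zf=\sigma(f)z$ for $f\in\mathcal S$, and put $\mathcal R=\mathcal S[z;\sigma]/(z^m-1)$. Identify $\mathbb F^{\ell m}$ with $\mathcal R$ by sending $(c^{(i)}_j)_{0\le i<\ell,\,0\le j<m}$ to the class of $c(x,z)=\sum_{j}\big(\sum_{i}c^{(i)}_jx^i\big)z^j$. A cyclic-skew-cyclic (CSC) code is an $\mathbb F$-linear subspace $\mathcal C\subseteq\mathbb F^{\ell m}$ stable under the cyclic block shift $(c^{(0)},\dots,c^{(\ell-1)})\mapsto(c^{(\ell-1)},c^{(0)},\dots,c^{(\ell-2)})$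 and under the map that acts on every block by $(c_0,\dots,c_{m-1})\mapsto(\sigma(c_{m-1}),\sigma(c_0),\dots,\sigma(c_{m-2}))$. Its minimal generator skew polynomial is the element $g=g(x,z)\in\mathcal S[z;\sigma]$ for which there is $h\in\mathcal S[z;\sigma]$ such that the images of $g$ and $h$ in $(\mathbb F[x]/(P))[z;\sigma]$ are monic in $z$ for every irreducible factor $P$ of $x^\ell-1$ in $\mathbb F[x]$, $\mathcal C$ is the left ideal of $\mathcal R$ generated by $g$, and $gh=hg=z^m-1$ in $\mathcal S[z;\sigma]$. For $f=f(z)\in\mathbb F_{q^m}[z;\sigma]$ and $\alpha\in\mathbb F_{q^m}$, let $f(\alpha)$ be the unique element of $\mathbb F_{q^m}$ with $f-f(\alpha)\in\mathbb F_{q^m}[z;\sigma](z-\alpha)$. For $a\in\mathbb F_q$ with $a^\ell=1$, $\beta\in\mathbb F_{q^m}\setminus\{0\}$ and $c=\sum_{j<m}f_j(x)z^j\in\mathcal R$, the total evaluation $c(a,1^\beta)$ is the value of $c(a,z)=\sum_j f_j(a)z^j$ at $1^\beta=\sigma(\beta)\beta^{-1}$. The defining set of $\mathcal C$ is $$T_{\mathcal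 C}=\{(a,\beta)\in\mathbb F_q\times(\mathbb F_{q^m}\setminus\{0\}) : a^\ell=1,\ g(a,1^\beta)=0\}.$$ **Theorem.** Let $\mathcal C$ be a CSC code. Then its minimal generator skew polynomial exists and is unique (so $T_{\mathcal C}$ is well defined), and: 1. for every $c(x,z)\in\mathcal R$, one has $c(x,z)\in\mathcal C$ if and only if $c(a,1^\beta)=0$ for all $(a,\beta)\in T_{\mathcal C}$; 2. for every CSC code $\widetilde{\mathcal C}$ (with the same parameters), $\mathcal C=\widetilde{\mathcal C}$ if and only if $T_{\mathcal C}=T_{\widetilde{\mathcal C}}$. -/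

import Mathlib

open Polynomial

noncomputable section

namespace CSC

/-! ### Skew polynomial rings `R[z; σ]` -/

section SkewPolynomials

/-- A copy of the ring `R` on which the monoid `ℕ` acts through the powers of `σ`. -/
def Twisted (R : Type*) [CommRing R] (_σ : R →+* R) : Type _ := R

instance (R : Type*) [CommRing R] (σ : R →+* R) : CommRing (Twisted R σ) :=
  inferInstanceAs (CommRing R)

instance (R : Type*) [CommRing R] (σ : R →+* R) :
    MulSemiringAction (Multiplicative ℕ) (Twisted R σ) where
  smul n a := (σ ^ n.toAdd : R →+* R) a
  one_smul _ := rfl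
  mul_smul m n a := by
    change (σ ^ (m.toAdd + n.toAdd) : R →+* R) a = (σ ^ m.toAdd) ((σ ^ n.toAdd) a)
    rw [pow_add]; rfl
  smul_zero n := map_zero (σ ^ n.toAdd : R →+* R)
  smul_add n := map_add (σ ^ n.toAdd : R →+* R)
  smul_one n := map_one (σ ^ n.toAdd : R →+* R)
  smul_mul n := map_mul (σ ^ n.toAdd : R →+* R)

/-- The skew polynomial ring `R[z; σ]`, with coefficients on the left and `z a = σ(a) z`. -/
abbrev SkewPoly (R : Type*) [CommRing R] (σ : R →+* R) : Type _ :=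
  SkewPolynomial (Twisted R σ)

namespace SkewPoly

variable {R : Type*} [CommRing R] {σ : R →+* R}

/-- The monomial `a z ^ n`. -/
def mono (σ : R →+* R) (n : ℕ) (a : R) : SkewPoly R σ :=
  SkewPolynomial.monomial (R := Twisted R σ) n a

/-- The variable `z`. -/
def Z (σ : R →+* R) : SkewPoly R σ := mono σ 1 1

/-- The coefficient (in `R`) of `z ^ n`. -/
def coef (f : SkewPoly R σ) (n : ℕ) : R := SkewPolynomial.coeff f n

theorem phi_iterate (n : ℕ) (a : Twisted R σ) :
    ((SkewPolynomial.φ : Twisted R σ →+* Twisted R σ)^[n] a) = (σ ^ n : R →+* R) a :=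
  SkewPolynomial.φ_iterate_apply n a

theorem mono_mul_mono (n k : ℕ) (a b : R) :
    mono σ n a * mono σ k b = mono σ (n + k) (a * (σ ^ n : R →+* R) b) :=
  (SkewPolynomial.monomial_mul_monomial (R := Twisted R σ) n k a b).trans
    (congrArg (fun x : R => mono σ (n + k) (a * x)) (phi_iterate (σ := σ) n b))

/-- The defining commutation rule `z a = σ(a) z`. -/
theorem Z_mul_C (a : R) : Z σ * mono σ 0 a = mono σ 0 (σ a) * Z σ := by
  simp [Z, mono_mul_mono]

theorem Z_pow (n : ℕ) : Z σ ^ n = mono σ n 1 := by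
  induction n with
  | zero => rfl
  | succ n ih => rw [pow_succ, ih, Z, mono_mul_mono]; simp

@[elab_as_elim]
theorem induction {P : SkewPoly R σ → Prop} (f : SkewPoly R σ) (h0 : P 0)
    (hm : ∀ n a, P (mono σ n a)) (hadd : ∀ f g, P f → P g → P (f + g)) : P f :=
  SkewPolynomial.induction f h0 fun n r _ _ _ hq => hadd _ _ (hm n r) hq

/-- The coefficientwise extension of a ring morphism to skew polynomials:
`∑ fₙ zⁿ ↦ ∑ τ(fₙ) zⁿ`. -/
def map {R' : Type*} [CommRing R'] (σ' : R' →+* R') (τ : R →+* R') :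
    SkewPoly R σ →+ SkewPoly R' σ' :=
  (SkewMonoidAlgebra.coeffAddEquiv (k := Twisted R' σ') (G := Multiplicative ℕ)).symm.toAddMonoidHom.comp
    ((Finsupp.mapRange.addMonoidHom (M := Twisted R σ) (N := Twisted R' σ') τ.toAddMonoidHom).comp
      (SkewMonoidAlgebra.coeffAddEquiv (k := Twisted R σ) (G := Multiplicative ℕ)).toAddMonoidHom)

theorem map_mono {R' : Type*} [CommRing R'] (σ' : R' →+* R') (τ : R →+* R') (n : ℕ) (a : R) :
    map σ' τ (mono σ n a) = mono σ' n (τ a) := by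
  apply SkewMonoidAlgebra.coeff_injective
  exact Finsupp.mapRange_single (hf := map_zero τ.toAddMonoidHom)

/-! ### Evaluation at a point as the remainder of right division -/

/-- `N_n(α) = σ^{n-1}(α) ⋯ σ(α) α`. -/
def normAt (σ : R →+* R) (α : R) (n : ℕ) : R := ∏ i ∈ Finset.range n, (σ ^ i : R →+* R) α

/-- `∑ fₙ zⁿ ↦ ∑ fₙ N_n(α)`. -/
def remHom (σ : R →+* R) (α : R) : SkewPoly R σ →+ R :=
  (Finsupp.liftAddHom (M := Twisted R σ) (N := R)
      fun n : Multiplicative ℕ => (AddMonoidHom.mulRight (normAt σ α n.toAdd) : R →+ R)).comp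
    (SkewMonoidAlgebra.coeffAddEquiv (k := Twisted R σ) (G := Multiplicative ℕ)).toAddMonoidHom

theorem remHom_mono (α : R) (n : ℕ) (a : R) :
    remHom σ α (mono σ n a) = a * normAt σ α n :=
  Finsupp.liftAddHom_apply_single (M := Twisted R σ) (N := R) _ _ _

theorem remHom_mul (α : R) (g : SkewPoly R σ) : remHom σ α (g * (Z σ - mono σ 0 α)) = 0 := by
  induction g using SkewPoly.induction with
  | h0 => simp
  | hm n a =>
    rw [mul_sub, Z, mono_mul_mono, mono_mul_mono, map_sub, remHom_mono, remHom_mono, normAt, normAt,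
      Finset.prod_range_succ]
    simp; ring
  | hadd f g hf hg => rw [add_mul, map_add, hf, hg, add_zero]

theorem exists_division (α : R) (f : SkewPoly R σ) :
    ∃ g : SkewPoly R σ, f = g * (Z σ - mono σ 0 α) + mono σ 0 (remHom σ α f) := by
  have hadd0 : ∀ a b : R, mono σ 0 (a + b) = mono σ 0 a + mono σ 0 b :=
    fun a b => SkewPolynomial.monomial_add (R := Twisted R σ) 0 a b
  induction f using SkewPoly.induction with
  | h0 => exact ⟨0, by
      rw [map_zero, zero_mul, zero_add]; exact (
        (SkewPolynomial.monomial_zero_right (R := Twisted R σ) 0).symm)⟩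
  | hm n a =>
    rw [remHom_mono]
    induction n generalizing a with
    | zero => exact ⟨0, by simp [normAt]⟩
    | succ n ih =>
      obtain ⟨g, hg⟩ := ih (a * (σ ^ n : R →+* R) α)
      refine ⟨g + mono σ n a, ?_⟩
      have h1 : mono σ n a * (Z σ - mono σ 0 α)
          = mono σ (n + 1) a - mono σ n (a * (σ ^ n : R →+* R) α) := by
        rw [mul_sub, Z, mono_mul_mono, mono_mul_mono]; simp
      have h2 : a * (σ ^ n : R →+* R) α * normAt σ α n = a * normAt σ α (n + 1) := by
        rw [normAt, normAt, Finset.prod_range_succ]; ring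
      rw [h2] at hg
      rw [add_mul, h1, add_right_comm, ← hg]; abel
  | hadd f g hf hg =>
    obtain ⟨u, hu⟩ := hf
    obtain ⟨v, hv⟩ := hg
    refine ⟨u + v, ?_⟩
    rw [map_add, hadd0, add_mul]
    nth_rewrite 1 [hu, hv]
    abel

theorem existsUnique_remainder (α : R) (f : SkewPoly R σ) :
    ∃! r : R, ∃ g : SkewPoly R σ, f = g * (Z σ - mono σ 0 α) + mono σ 0 r := by
  refine ⟨remHom σ α f, exists_division α f, ?_⟩
  rintro r ⟨g, rfl⟩
  rw [map_add, remHom_mul, remHom_mono]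
  simp [normAt]

/-- The evaluation `f(α)`: the unique `r` with `f = g (z - α) + r` for some skew polynomial `g`. -/
def eval (α : R) (f : SkewPoly R σ) : R := (existsUnique_remainder α f).choose

theorem eval_eq_remHom (α : R) (f : SkewPoly R σ) : eval α f = remHom σ α f :=
  ((existsUnique_remainder α f).choose_spec.2 _ (exists_division α f)).symm

end SkewPoly

/-! ### The quotient `R[z; σ] / (z ^ N - 1)` -/

open SkewPoly

/-- The left ideal of `R[z; σ]` generated by `z ^ N - 1`. -/
abbrev zIdeal (R : Type*) [CommRing R] (σ : R →+* R) (N : ℕ) : Ideal (SkewPoly R σ) :=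
  Ideal.span {Z σ ^ N - 1}

/-- `R[z; σ] / (z ^ N - 1)`: a left `R[z; σ]`-module, and a ring as soon as `σ ^ N` is the
identity. -/
abbrev SkewQuot (R : Type*) [CommRing R] (σ : R →+* R) (N : ℕ) : Type _ :=
  SkewPoly R σ ⧸ zIdeal R σ N

/-- The class of a skew polynomial modulo `z ^ N - 1`. -/
abbrev toQuot {R : Type*} [CommRing R] {σ : R →+* R} (N : ℕ) (f : SkewPoly R σ) :
    SkewQuot R σ N :=
  Submodule.Quotient.mk f

variable {R : Type*} [CommRing R] {σ : R →+* R} {N : ℕ}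

theorem mul_zN_comm [h : Fact (σ ^ N = 1)] (f : SkewPoly R σ) :
    f * (Z σ ^ N - 1) = (Z σ ^ N - 1) * f := by
  induction f using SkewPoly.induction with
  | h0 => simp
  | hm n a =>
    rw [mul_sub, sub_mul, Z_pow, mono_mul_mono, mono_mul_mono, h.out, map_one, mul_one, one_mul,
      mul_one, one_mul, RingHom.coe_one, id, add_comm]
  | hadd f g hf hg => rw [add_mul, mul_add, hf, hg]

instance [Fact (σ ^ N = 1)] : (zIdeal R σ N).IsTwoSided where
  mul_mem_of_left b ha := by
    obtain ⟨c, rfl⟩ := Ideal.mem_span_singleton'.mp ha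
    refine Ideal.mem_span_singleton'.mpr ⟨c * b, ?_⟩
    rw [mul_assoc, mul_zN_comm, mul_assoc]

/-- An additive map on `R[z; σ]` that kills the left ideal `(z ^ N - 1)` descends to the
quotient. -/
def liftQuot {A : Type*} [AddCommGroup A] (φ : SkewPoly R σ →+ A)
    (h : ∀ f : SkewPoly R σ, φ (f * (Z σ ^ N - 1)) = 0) : SkewQuot R σ N →+ A :=
  QuotientAddGroup.lift (zIdeal R σ N).toAddSubgroup φ fun x hx => by
    obtain ⟨c, rfl⟩ := Ideal.mem_span_singleton'.mp hx
    exact h c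

theorem liftQuot_mk {A : Type*} [AddCommGroup A] (φ : SkewPoly R σ →+ A)
    (h : ∀ f : SkewPoly R σ, φ (f * (Z σ ^ N - 1)) = 0) (f : SkewPoly R σ) :
    liftQuot φ h (toQuot N f) = φ f := rfl

end SkewPolynomials

/-! ### The rings `𝒮 = F[x] / (x ^ ℓ - 1)` and `ℛ = 𝒮[z; σ] / (z ^ N - 1)` -/

section Rings

/-- `𝒮 = F[x] / (x ^ ℓ - 1)`. -/
abbrev S (F : Type*) [Field F] (ℓ : ℕ) : Type _ := AdjoinRoot (X ^ ℓ - 1 : F[X])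

variable {F : Type*} [Field F]

/-- The extension of `σ` to `𝒮` with `σ(x) = x`. -/
def sigmaS (σ : F →+* F) (ℓ : ℕ) : S F ℓ →+* S F ℓ :=
  AdjoinRoot.map σ (X ^ ℓ - 1) (X ^ ℓ - 1) (by simp)

/-- `𝒮[z; σ]`. -/
abbrev Sz (σ : F →+* F) (ℓ : ℕ) : Type _ := SkewPoly (S F ℓ) (sigmaS σ ℓ)

/-- `ℛ = 𝒮[z; σ] / (z ^ N - 1)`. -/
abbrev RR (σ : F →+* F) (ℓ N : ℕ) : Type _ := SkewQuot (S F ℓ) (sigmaS σ ℓ) N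

instance (σ : F →+* F) (ℓ N : ℕ) [h : Fact (σ ^ N = 1)] : Fact (sigmaS σ ℓ ^ N = 1) := ⟨by
  have key : ∀ n, ∀ a, (sigmaS σ ℓ ^ n : S F ℓ →+* S F ℓ) (AdjoinRoot.of _ a)
      = AdjoinRoot.of _ ((σ ^ n : F →+* F) a) := by
    intro n
    induction n with
    | zero => intro a; rfl
    | succ n ih =>
      intro a
      rw [pow_succ, pow_succ, RingHom.mul_def, RingHom.comp_apply, RingHom.mul_def,
        RingHom.comp_apply, ← ih]
      simp [sigmaS]
  have key' : ∀ n, (sigmaS σ ℓ ^ n : S F ℓ →+* S F ℓ) (AdjoinRoot.root _)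
      = AdjoinRoot.root _ := by
    intro n
    induction n with
    | zero => rfl
    | succ n ih =>
      rw [pow_succ, RingHom.mul_def, RingHom.comp_apply]
      simpa [sigmaS] using ih
  refine AdjoinRoot.ringHom_ext ?_ ?_
  · ext a
    rw [RingHom.comp_apply, key, h.out]; rfl
  · rw [key']; rfl⟩

end Rings

/-! ### Cyclic-skew-cyclic codes -/

section Codes

variable {F : Type*} [Field F] {ℓ N : ℕ}

/-- The cyclic inter-block shift `(c⁽⁰⁾, …, c⁽ℓ⁻¹⁾) ↦ (c⁽ℓ⁻¹⁾, c⁽⁰⁾, …, c⁽ℓ⁻²⁾)`; the word `c` has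
the coordinate `c i j` at position `j` of its `i`-th block. -/
def interShift [NeZero ℓ] (c : Fin ℓ → Fin N → F) : Fin ℓ → Fin N → F :=
  fun i j => c (i - 1) j

/-- The skew-cyclic intra-block shift, acting on each block by
`(c₀, …, c_{N-1}) ↦ (σ(c_{N-1}), σ(c₀), …, σ(c_{N-2}))`. -/
def intraShift [NeZero N] (σ : F →+* F) (c : Fin ℓ → Fin N → F) : Fin ℓ → Fin N → F :=
  fun i j => σ (c i (j - 1))

/-- An `F`-linear code in `F ^ (ℓ N)` is cyclic-skew-cyclic if it is stable under both shifts. -/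
structure IsCSC [NeZero ℓ] [NeZero N] (σ : F →+* F)
    (C : Submodule F (Fin ℓ → Fin N → F)) : Prop where
  inter : ∀ c ∈ C, interShift c ∈ C
  intra : ∀ c ∈ C, intraShift σ c ∈ C

/-- The identification `ν : F ^ (ℓ N) → ℛ`, sending `c` to the class of
`∑ⱼ (∑ᵢ c⁽ⁱ⁾ⱼ xⁱ) zʲ`. -/
def nu (σ : F →+* F) (c : Fin ℓ → Fin N → F) : RR σ ℓ N :=
  toQuot N (∑ j : Fin N, SkewPoly.mono (sigmaS σ ℓ) j
    (∑ i : Fin ℓ, AdjoinRoot.of _ (c i j) * AdjoinRoot.root (X ^ ℓ - 1 : F[X]) ^ (i : ℕ)))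

/-- The code `C`, seen as a subset of `ℛ`. -/
def codeInR (σ : F →+* F) (C : Submodule F (Fin ℓ → Fin N → F)) : Set (RR σ ℓ N) :=
  nu σ '' (C : Set (Fin ℓ → Fin N → F))

/-- The projection `𝒮 = F[x]/(x ^ ℓ - 1) → F[x]/(P)` for a divisor `P` of `x ^ ℓ - 1`. -/
def projS {P : F[X]} (h : P ∣ X ^ ℓ - 1) : S F ℓ →+* AdjoinRoot P :=
  AdjoinRoot.map (RingHom.id F) (X ^ ℓ - 1) P (by simpa using h)

/-- For every irreducible factor `P` of `x ^ ℓ - 1` in `F[x]`, the image of `f ∈ 𝒮[z; σ]` under the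
coefficientwise projection to `(F[x]/(P))[z; σ]` is monic in `z`. -/
def IsComponentwiseMonic {σ : F →+* F} (f : Sz σ ℓ) : Prop :=
  ∀ (P : F[X]) (hP : P ∣ X ^ ℓ - 1), Irreducible P →
    ∃ d : ℕ, projS hP (SkewPoly.coef f d) = 1 ∧ ∀ n, d < n → projS hP (SkewPoly.coef f n) = 0

/-- `g` and `h` are the minimal generator and the minimal check skew polynomial of `C`. -/
structure IsMinimalPair (σ : F →+* F) [Fact (σ ^ N = 1)]
    (C : Submodule F (Fin ℓ → Fin N → F)) (g h : Sz σ ℓ) : Prop where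
  monic_gen : IsComponentwiseMonic g
  monic_check : IsComponentwiseMonic h
  generates : codeInR σ C = (Ideal.span {toQuot N g} : Ideal (RR σ ℓ N))
  gen_mul_check : g * h = SkewPoly.Z (sigmaS σ ℓ) ^ N - 1
  check_mul_gen : h * g = SkewPoly.Z (sigmaS σ ℓ) ^ N - 1

open Classical in
/-- The minimal generator skew polynomial `g(x, z)` of a code (`0` if there is none). -/
def minimalGenerator (σ : F →+* F) [Fact (σ ^ N = 1)] (C : Submodule F (Fin ℓ → Fin N → F)) :
    Sz σ ℓ :=
  if hC : ∃ g, ∃ h, IsMinimalPair σ C g h then hC.choose else 0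

end Codes

/-! ### Total evaluation and the defining set -/

section Evaluation

variable {F K : Type*} [Field F] [Field K] [Algebra F K] {ℓ m : ℕ}

/-- The evaluation `Ev_a : F[x]/(x ^ ℓ - 1) → K`, `f(x) ↦ f(a)`. -/
def evA (F : Type*) [Field F] [Algebra F K] (a : K) (ha : a ^ ℓ = 1) : S F ℓ →+* K :=
  AdjoinRoot.lift (algebraMap F K) a (by simp [ha])

/-- The partial evaluation `Ev_{a,z} : ℛ → K[z; σ]/(z ^ m - 1)`,
`∑ fⱼ(x) zʲ ↦ ∑ fⱼ(a) zʲ`. -/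
def partialEval (σF : F →+* F) (σK : K →+* K) (m : ℕ) (a : K) (ha : a ^ ℓ = 1) :
    RR σF ℓ m →+ SkewQuot K σK m :=
  liftQuot
    ((Submodule.mkQ (zIdeal K σK m)).toAddMonoidHom.comp (SkewPoly.map σK (evA F a ha)))
    (fun f => by
      induction f using SkewPoly.induction with
      | h0 => simp
      | hm n b =>
        have h1 : SkewPoly.map σK (evA F a ha)
              (SkewPoly.mono (sigmaS σF ℓ) n b * (SkewPoly.Z (sigmaS σF ℓ) ^ m - 1))
            = SkewPoly.mono σK n (evA F a ha b) * (SkewPoly.Z σK ^ m - 1) := by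
          rw [mul_sub, mul_sub, SkewPoly.Z_pow, SkewPoly.Z_pow, SkewPoly.mono_mul_mono,
            SkewPoly.mono_mul_mono, map_one, map_one, mul_one, mul_one, mul_one, mul_one,
            map_sub, SkewPoly.map_mono, SkewPoly.map_mono]
        rw [AddMonoidHom.comp_apply, h1]
        exact (Submodule.Quotient.mk_eq_zero _).mpr
          (Ideal.mem_span_singleton'.mpr ⟨_, rfl⟩)
      | hadd f g hf hg => rw [add_mul, map_add, hf, hg, add_zero])

/-- The conjugate `1 ^ β = σ(β) β⁻¹`. -/
def conjOne (σ : K →+* K) (β : Kˣ) : K := σ β * (β : K)⁻¹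

theorem normAt_conjOne (σ : K →+* K) (β : Kˣ) (n : ℕ) :
    SkewPoly.normAt σ (conjOne σ β) n = (σ ^ n : K →+* K) β * (β : K)⁻¹ := by
  induction n with
  | zero => simp [SkewPoly.normAt]
  | succ n ih =>
    rw [SkewPoly.normAt, Finset.prod_range_succ, ← SkewPoly.normAt, ih, conjOne, map_mul, map_inv₀,
      pow_succ, RingHom.mul_def, RingHom.comp_apply]
    have : (σ ^ n : K →+* K) (β : K) ≠ 0 :=
      (map_ne_zero (σ ^ n : K →+* K)).mpr β.ne_zero
    field_simp

/-- The evaluation `Ev^σ_β : K[z; σ]/(z ^ m - 1) → K`, `f(z) ↦ f(1 ^ β)`. -/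
def evBeta (σ : K →+* K) [hσ : Fact (σ ^ m = 1)] (β : Kˣ) : SkewQuot K σ m →+ K :=
  liftQuot
    { toFun := fun f => SkewPoly.eval (conjOne σ β) f
      map_zero' := by rw [SkewPoly.eval_eq_remHom, map_zero]
      map_add' := fun f g => by simp only [SkewPoly.eval_eq_remHom, map_add] }
    (fun f => by
      change SkewPoly.eval _ _ = 0
      rw [SkewPoly.eval_eq_remHom]
      induction f using SkewPoly.induction with
      | h0 => simp
      | hm n b =>
        rw [mul_sub, SkewPoly.Z_pow, SkewPoly.mono_mul_mono, map_one, mul_one, mul_one, map_sub,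
          SkewPoly.remHom_mono, SkewPoly.remHom_mono, normAt_conjOne, normAt_conjOne, pow_add,
          hσ.out, mul_one, sub_self]
      | hadd f g hf hg => rw [add_mul, map_add, hf, hg, add_zero])

/-- The total evaluation `Ev_{a,β} = Ev^σ_β ∘ Ev_{a,z} : ℛ → K`, `c(x, z) ↦ c(a, 1 ^ β)`. -/
def totalEval (σF : F →+* F) (σK : K →+* K) [Fact (σK ^ m = 1)] (a : K) (ha : a ^ ℓ = 1)
    (β : Kˣ) : RR σF ℓ m →+ K :=
  (evBeta σK β).comp (partialEval σF σK m a ha)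

theorem map_pow_eq_one {E : Type*} [Field E] [Algebra E K] {a : E} (ha : a ^ ℓ = 1) :
    algebraMap E K a ^ ℓ = 1 := by
  rw [← map_pow, ha, map_one]

/-- The defining set `T_C`: the pairs `(a, β) ∈ E × (K ∖ {0})` with `a ^ ℓ = 1` and
`g(a, 1 ^ β) = 0`, where `g` is the minimal generator skew polynomial of `C`. -/
def definingSet (E : Type*) [Field E] [Algebra E K] (σF : F →+* F) (σK : K →+* K)
    [Fact (σF ^ m = 1)] [Fact (σK ^ m = 1)] (C : Submodule F (Fin ℓ → Fin m → F)) :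
    Set (E × Kˣ) :=
  {t | ∃ ha : t.1 ^ ℓ = 1,
    totalEval σF σK (algebraMap E K t.1) (map_pow_eq_one ha) t.2
      (toQuot m (minimalGenerator σF C)) = 0}

end Evaluation

/-! ### The `q`-th power map of the finite fields -/

section Frobenius

variable {F : Type*} [Field F] {p e s m : ℕ} [hp : Fact p.Prime]

theorem iterateFrobenius_pow_eq_one [CharP F p] (k n : ℕ) (h : ∀ x : F, x ^ p ^ (k * n) = x) :
    iterateFrobenius F p k ^ n = 1 := by
  ext x
  rw [RingHom.coe_pow, ← coe_iterateFrobenius_mul, iterateFrobenius_def, h]; rfl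

theorem pow_card_pow (k n : ℕ) [hF : Fact (Nat.card F = p ^ k)] (x : F) : x ^ p ^ (k * n) = x := by
  have : Finite F := Nat.finite_of_card_ne_zero (by rw [hF.out]; exact (pow_pos hp.out.pos _).ne')
  have := Fintype.ofFinite F
  have h := FiniteField.pow_card_pow n x
  rwa [← Nat.card_eq_fintype_card, hF.out, ← pow_mul] at h

/-- On the field with `q₀ ^ m` elements, where `q₀ = p ^ e`, the `m`-th power of
`x ↦ x ^ (q₀ ^ s)` is the identity. -/
instance [CharP F p] [Fact (Nat.card F = p ^ (e * m))] : Fact (iterateFrobenius F p (e * s) ^ m = 1) :=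
  ⟨iterateFrobenius_pow_eq_one _ _ fun x => by
    rw [mul_right_comm]; exact pow_card_pow (e * m) s x⟩

/-- On the field with `q ^ m` elements, where `q = p ^ (e * s)`, the `m`-th power of `x ↦ x ^ q` is
the identity. -/
instance [CharP F p] [Fact (Nat.card F = p ^ (e * s * m))] : Fact (iterateFrobenius F p (e * s) ^ m = 1) :=
  ⟨iterateFrobenius_pow_eq_one _ _ fun x => by
    simpa using pow_card_pow (e * s * m) 1 x⟩

end Frobenius

end CSC

end

/-!
The skew polynomials over `𝒮 = F[x]/(x ^ ℓ - 1)` are studied through their values at the roots `a`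
of `x ^ ℓ - 1`. These roots lie in `F_q`, so they are fixed by `σ` and evaluation at `a` is a ring
morphism `τ : 𝒮 → K` with `τ ∘ σ = σ ∘ τ`; they are `ℓ` in number, so the evaluations are jointly
injective. No decomposition of `𝒮` into fields is needed: since `K` is finite, powers of elements
of `𝒮` provide idempotents that separate the evaluations with different kernels
(`exists_separating`) and inverses of the leading coefficients. This makes membership in a left
ideal a local condition (`mem_of_forall_congr`) and allows gluing (`exists_glue`).

*The generator.* A code is the image of a left ideal `I` of `𝒮[z; σ]` that contains `z ^ m - 1`
(`codeIdeal`). At each root, `I` has a monic element of least degree. These glue to an element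
`g` of `I`, monic of least degree at every root, which generates `I` by right division with
remainder at each root (`exists_leastMonic_generator`, `eq_span_of_leastMonic`). Hence
`z ^ m - 1 = h g`, and `g h = z ^ m - 1` too, because `z ^ m - 1` is central and `g` is cancellable.
Uniqueness is the usual comparison of degrees (`generator_unique`).

*The defining set.* Up to the factor `β`, the value of `c` at `(a, 1 ^ β)` is the value at `β` of
the `F_q`-linear operator `∑ cₙ(a) σⁿ` (`totalEval_toQuot`), and products of skew polynomials act as
compositions (`skewOp_mul`). So the fibre of the defining set over `a` is the kernel of the operator
of `g`, without `0`. The operator of a skew polynomial of degree `d` is an ordinary polynomial of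
degree `q ^ d`, so its kernel has at most `q ^ d` elements. As `h g` acts as zero,
`q ^ m ≤ |ker g| |ker h| ≤ q ^ (deg g + deg h) = q ^ m`, so `|ker g| = q ^ (deg g)`. The remainder
modulo `g` of an element that vanishes on this kernel has more zeros than its degree allows,
hence is zero (`degLT_zero_of_ker_le`), and membership follows from its local criterion. A code is
thereby determined by its defining set, because `ν` is injective (`nu_injective`).
-/

noncomputable section

namespace CSC

namespace SkewPoly

/-! ### Coefficients of skew polynomials -/

section Coefficients

variable {R : Type*} [CommRing R] {σ : R →+* R}

@[simp] theorem coef_zero (n : ℕ) : coef (0 : SkewPoly R σ) n = 0 := rfl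

@[simp] theorem coef_add (f g : SkewPoly R σ) (n : ℕ) : coef (f + g) n = coef f n + coef g n :=
  SkewPolynomial.coeff_add (R := Twisted R σ) f g n

@[simp] theorem coef_sub (f g : SkewPoly R σ) (n : ℕ) : coef (f - g) n = coef f n - coef g n :=
  SkewPolynomial.coeff_sub (R := Twisted R σ) f g n

theorem coef_mono (n : ℕ) (a : R) (k : ℕ) : coef (mono σ n a) k = if n = k then a else 0 :=
  SkewPolynomial.coeff_monomial (R := Twisted R σ)

@[simp] theorem mono_zero (n : ℕ) : mono σ n 0 = 0 :=
  SkewPolynomial.monomial_zero_right (R := Twisted R σ) n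

theorem mono_add (n : ℕ) (a b : R) : mono σ n (a + b) = mono σ n a + mono σ n b :=
  SkewPolynomial.monomial_add (R := Twisted R σ) n a b

theorem mono_zero_one : mono σ 0 (1 : R) = 1 := rfl

theorem ext_coef {f g : SkewPoly R σ} (h : ∀ n, coef f n = coef g n) : f = g :=
  SkewPolynomial.ext (R := Twisted R σ) h

theorem exists_coef_eq_zero (f : SkewPoly R σ) : ∃ N, ∀ n, N ≤ n → coef f n = 0 := by
  induction f using SkewPoly.induction with
  | h0 => exact ⟨0, fun n _ => rfl⟩
  | hm n a => exact ⟨n + 1, fun k hk => by rw [coef_mono, if_neg (by omega)]⟩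
  | hadd f g hf hg =>
    obtain ⟨M, hM⟩ := hf
    obtain ⟨N, hN⟩ := hg
    exact ⟨max M N, fun n hn => by
      rw [coef_add, hM n (by omega), hN n (by omega), add_zero]⟩

theorem coef_mono_mul (n : ℕ) (a : R) (f : SkewPoly R σ) (k : ℕ) :
    coef (mono σ n a * f) k = if n ≤ k then a * (σ ^ n : R →+* R) (coef f (k - n)) else 0 := by
  induction f using SkewPoly.induction with
  | h0 => simp
  | hm j b =>
    rw [mono_mul_mono, coef_mono, coef_mono]
    by_cases h : n ≤ k
    · rw [if_pos h]
      by_cases h' : n + j = k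
      · rw [if_pos h', if_pos (by omega)]
      · rw [if_neg h', if_neg (by omega), map_zero, mul_zero]
    · rw [if_neg h, if_neg (by omega)]
  | hadd f g hf hg =>
    rw [mul_add, coef_add, hf, hg, coef_add, map_add]
    split_ifs
    · ring
    · simp

@[simp] theorem coef_C_mul (a : R) (f : SkewPoly R σ) (k : ℕ) :
    coef (mono σ 0 a * f) k = a * coef f k := by
  simp [coef_mono_mul]

theorem coef_mul (f g : SkewPoly R σ) (k : ℕ) :
    coef (f * g) k
      = ∑ i ∈ Finset.range (k + 1), coef f i * (σ ^ i : R →+* R) (coef g (k - i)) := by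
  induction f using SkewPoly.induction with
  | h0 => simp
  | hm n a =>
    rw [coef_mono_mul]
    simp only [coef_mono, ite_mul, zero_mul]
    rw [Finset.sum_ite_eq]
    simp
  | hadd f g hf hg => simp [add_mul, hf, hg, Finset.sum_add_distrib]

theorem coef_Z_pow_sub_one (N k : ℕ) :
    coef (Z σ ^ N - 1) k = (if N = k then 1 else 0) - (if 0 = k then 1 else 0) := by
  rw [Z_pow, coef_sub, coef_mono, ← mono_zero_one, coef_mono]

end Coefficients

/-! ### Skew polynomials at a point of the coefficient ring -/

section Local

variable {R K : Type*} [CommRing R] [Field K] {σ : R →+* R} {σK : K →+* K} {τ : R →+* K}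

/-- After applying `τ` to its coefficients, `f` has degree less than `N` in `z`. -/
def DegLT (τ : R →+* K) (f : SkewPoly R σ) (N : ℕ) : Prop :=
  ∀ n, N ≤ n → τ (coef f n) = 0

/-- After applying `τ` to its coefficients, `f` is monic of degree `d` in `z`. -/
def MonicAt (τ : R →+* K) (f : SkewPoly R σ) (d : ℕ) : Prop :=
  τ (coef f d) = 1 ∧ DegLT τ f (d + 1)

theorem exists_degLT (τ : R →+* K) (f : SkewPoly R σ) : ∃ N, DegLT τ f N := by
  obtain ⟨N, hN⟩ := exists_coef_eq_zero f
  exact ⟨N, fun n hn => by rw [hN n hn, map_zero]⟩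

/-- A skew polynomial that does not vanish under `τ` has a degree and a leading coefficient
there. -/
theorem exists_leading {f : SkewPoly R σ} (h : ¬ DegLT τ f 0) :
    ∃ n, τ (coef f n) ≠ 0 ∧ DegLT τ f (n + 1) := by
  classical
  have hex := exists_degLT τ f
  have hpos : Nat.find hex ≠ 0 := fun h0 => h (h0 ▸ Nat.find_spec hex)
  obtain ⟨n, hn⟩ := Nat.exists_eq_succ_of_ne_zero hpos
  have hlt : DegLT τ f (n + 1) := by
    have := Nat.find_spec hex
    rwa [hn] at this
  refine ⟨n, fun h0 => Nat.find_min hex (m := n) (by omega) fun k hk => ?_, hlt⟩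
  obtain rfl | hk := hk.eq_or_lt
  · exact h0
  · exact hlt k hk

theorem monicAt_Z_pow_sub_one {N : ℕ} (hN : 0 < N) : MonicAt τ (Z σ ^ N - 1) N := by
  refine ⟨?_, fun n hn => ?_⟩
  · rw [coef_Z_pow_sub_one, if_pos rfl, if_neg (by omega), sub_zero, map_one]
  · rw [coef_Z_pow_sub_one, if_neg (by omega), if_neg (by omega), sub_zero, map_zero]

theorem DegLT.mono {f : SkewPoly R σ} {M N : ℕ} (h : DegLT τ f M) (hMN : M ≤ N) : DegLT τ f N :=
  fun n hn => h n (hMN.trans hn)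

theorem apply_iterate (hτ : ∀ r, τ (σ r) = σK (τ r)) (n : ℕ) (r : R) :
    τ ((σ ^ n : R →+* R) r) = (σK ^ n : K →+* K) (τ r) := by
  induction n generalizing r with
  | zero => rfl
  | succ n ih =>
    rw [pow_succ, pow_succ, RingHom.mul_def, RingHom.mul_def, RingHom.comp_apply,
      RingHom.comp_apply, ih, hτ]

theorem coef_mul_monicAt (hτ : ∀ r, τ (σ r) = σK (τ r)) {u g : SkewPoly R σ} {a d : ℕ}
    (hu : DegLT τ u (a + 1)) (hg : MonicAt τ g d) : τ (coef (u * g) (a + d)) = τ (coef u a) := by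
  rw [coef_mul, map_sum, Finset.sum_eq_single a]
  · rw [map_mul, apply_iterate hτ, Nat.add_sub_cancel_left, hg.1, map_one, mul_one]
  · intro i _ hi
    rw [map_mul, apply_iterate hτ]
    rcases Nat.lt_or_gt_of_ne hi with hlt | hlt
    · rw [hg.2 _ (by omega), map_zero, mul_zero]
    · rw [hu _ hlt, zero_mul]
  · intro h
    exact absurd (Finset.mem_range.mpr (by omega)) h

/-- A left multiple of a monic skew polynomial of degree `d` that has degree less than `d` has the
zero cofactor, since degrees add up. -/
theorem degLT_zero_of_mul (hτ : ∀ r, τ (σ r) = σK (τ r)) {u g : SkewPoly R σ} {d : ℕ}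
    (hg : MonicAt τ g d) (h : DegLT τ (u * g) d) : DegLT τ u 0 := by
  by_contra hu
  obtain ⟨n, hn, hlt⟩ := exists_leading hu
  exact hn ((coef_mul_monicAt hτ hlt hg).symm.trans (h _ (by omega)))

/-- The cofactor of a right divisor of a monic skew polynomial is monic, and degrees add up. -/
theorem MonicAt.left_of_mul (hτ : ∀ r, τ (σ r) = σK (τ r)) {u g : SkewPoly R σ} {d N : ℕ}
    (hg : MonicAt τ g d) (h : MonicAt τ (u * g) N) : ∃ n, n + d = N ∧ MonicAt τ u n := by
  have hu : ¬ DegLT τ u 0 := fun hu => by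
    refine one_ne_zero (h.1.symm.trans ?_)
    rw [coef_mul, map_sum]
    exact Finset.sum_eq_zero fun i _ => by rw [map_mul, hu i (Nat.zero_le i), zero_mul]
  obtain ⟨n, hn, hlt⟩ := exists_leading hu
  have hc := coef_mul_monicAt hτ hlt hg
  have hdeg : DegLT τ (u * g) (n + d + 1) := by
    intro k hk
    rw [coef_mul, map_sum]
    refine Finset.sum_eq_zero fun i _ => ?_
    rw [map_mul, apply_iterate hτ]
    by_cases hi : n < i
    · rw [hlt i hi, zero_mul]
    · rw [hg.2 _ (by omega), map_zero, mul_zero]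
  have hN : n + d = N := by
    by_contra hne
    rcases Nat.lt_or_gt_of_ne hne with h1 | h1
    · exact one_ne_zero (h.1.symm.trans (hdeg _ h1))
    · exact hn (hc.symm.trans (h.2 _ h1))
  exact ⟨n, hN, by rw [← hc, hN, h.1], hlt⟩

/-- Right division with remainder, at the point `τ`. -/
theorem exists_div_degLT (hτ : ∀ r, τ (σ r) = σK (τ r)) {g : SkewPoly R σ} {d : ℕ}
    (hg : MonicAt τ g d) (f : SkewPoly R σ) : ∃ u, DegLT τ (f - u * g) d := by
  obtain ⟨N, hN⟩ := exists_degLT τ f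
  suffices H : ∀ k f, DegLT τ f (k + d) → ∃ u, DegLT τ (f - u * g) d from
    H N f (hN.mono (by omega))
  intro k
  induction k with
  | zero => exact fun f hf => ⟨0, by simpa using hf⟩
  | succ k ih =>
    intro f hf
    obtain ⟨u, hu⟩ := ih (f - mono σ k (coef f (k + d)) * g) fun n hn => by
      rw [coef_sub, coef_mono_mul, if_pos (by omega), map_sub, map_mul, apply_iterate hτ]
      obtain rfl | hlt := hn.eq_or_lt
      · rw [Nat.add_sub_cancel_left, hg.1, map_one, mul_one, sub_self]
      · rw [hg.2 _ (by omega), hf n (by omega), map_zero, mul_zero, sub_zero]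
    exact ⟨mono σ k (coef f (k + d)) + u, by rwa [add_mul, ← sub_sub]⟩

theorem degLT_zero_of_mem_span (hτ : ∀ r, τ (σ r) = σK (τ r))
    {g : SkewPoly R σ} {d : ℕ} (hg : MonicAt τ g d) {f : SkewPoly R σ}
    (hf : f ∈ Ideal.span {g}) (hlt : DegLT τ f d) : DegLT τ f 0 := by
  obtain ⟨u, rfl⟩ := Ideal.mem_span_singleton'.mp hf
  have hu := degLT_zero_of_mul hτ hg hlt
  intro n _
  rw [coef_mul, map_sum]
  exact Finset.sum_eq_zero fun i _ => by rw [map_mul, hu i (Nat.zero_le i), zero_mul]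

theorem eq_of_forall_coef {ι : Type*} {τ : ι → R →+* K}
    (hinj : ∀ r, (∀ i, τ i r = 0) → r = 0) {f g : SkewPoly R σ}
    (h : ∀ i, DegLT (τ i) (f - g) 0) : f = g :=
  ext_coef fun n => sub_eq_zero.mp <| hinj _ fun i => by
    rw [← coef_sub]
    exact h i n (Nat.zero_le n)

theorem eq_of_mul_eq_mul_right {ι : Type*} {τ : ι → R →+* K}
    (hτ : ∀ i r, τ i (σ r) = σK (τ i r))
    (hinj : ∀ r, (∀ i, τ i r = 0) → r = 0) {f f' g : SkewPoly R σ}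
    (hg : ∀ i, ∃ d, MonicAt (τ i) g d) (h : f * g = f' * g) : f = f' :=
  eq_of_forall_coef hinj fun i => by
    obtain ⟨d, hd⟩ := hg i
    refine degLT_zero_of_mul (hτ i) hd fun n _ => ?_
    rw [sub_mul, h, sub_self, coef_zero, map_zero]

/-- Two generators of the same left ideal, monic at every point, coincide: at every point their
degrees agree, and their difference has smaller degree. -/
theorem generator_unique {ι : Type*} {τ : ι → R →+* K}
    (hτ : ∀ i r, τ i (σ r) = σK (τ i r))
    (hinj : ∀ r, (∀ i, τ i r = 0) → r = 0) {g g' : SkewPoly R σ}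
    (hg : ∀ i, ∃ d, MonicAt (τ i) g d) (hg' : ∀ i, ∃ d, MonicAt (τ i) g' d)
    (h : (Ideal.span {g} : Ideal (SkewPoly R σ)) = Ideal.span {g'}) : g = g' := by
  have hmem : g ∈ (Ideal.span {g} : Ideal (SkewPoly R σ)) := Ideal.mem_span_singleton_self g
  have hmem' : g' ∈ (Ideal.span {g} : Ideal (SkewPoly R σ)) :=
    h ▸ Ideal.mem_span_singleton_self g'
  refine eq_of_forall_coef hinj fun i => ?_
  obtain ⟨d, hd⟩ := hg i
  obtain ⟨d', hd'⟩ := hg' i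
  have key : ∀ {a b : ℕ} {u v : SkewPoly R σ}, MonicAt (τ i) u a → MonicAt (τ i) v b →
      v ∈ (Ideal.span {u} : Ideal (SkewPoly R σ)) → a ≤ b := by
    intro a b u v hu hv hvu
    by_contra hlt
    refine one_ne_zero (hv.1.symm.trans (degLT_zero_of_mem_span (hτ i) hu hvu ?_ b (Nat.zero_le b)))
    exact hv.2.mono (by omega)
  obtain rfl : d = d' := le_antisymm (key hd hd' hmem') (key hd' hd (h ▸ hmem))
  refine degLT_zero_of_mem_span (hτ i) hd (Ideal.sub_mem _ hmem hmem') fun n hn => ?_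
  rw [coef_sub, map_sub]
  obtain rfl | hlt := hn.eq_or_lt
  · rw [hd.1, hd'.1, sub_self]
  · rw [hd.2 n hlt, hd'.2 n hlt, sub_self]

/-- `g` is monic at `τ`, of the least degree that a nonzero element of `I` has there. -/
def IsLeastMonicAt (τ : R →+* K) (I : Ideal (SkewPoly R σ)) (g : SkewPoly R σ) : Prop :=
  ∃ d, MonicAt τ g d ∧ ∀ f ∈ I, DegLT τ f d → DegLT τ f 0

theorem exists_isLeastMonicAt [Finite K] {I : Ideal (SkewPoly R σ)}
    (hI : ∃ f ∈ I, ∃ d, MonicAt τ f d) : ∃ g ∈ I, IsLeastMonicAt τ I g := by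
  classical
  have hex : ∃ d, ∃ f ∈ I, MonicAt τ f d := by
    obtain ⟨f, hf, d, hd⟩ := hI
    exact ⟨d, f, hf, hd⟩
  obtain ⟨g, hgI, hg⟩ := Nat.find_spec hex
  refine ⟨g, hgI, _, hg, fun f hf hlt => ?_⟩
  by_contra h0
  obtain ⟨n, hn, hn'⟩ := exists_leading h0
  have hnlt : n < Nat.find hex := by
    by_contra hle
    exact hn (hlt n (by omega))
  -- In a finite field the inverse is a power, so the leading coefficient is inverted inside `R`.
  have := Fintype.ofFinite K
  have hinv : τ (coef f n ^ (Fintype.card K - 2)) * τ (coef f n) = 1 := by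
    rw [map_pow, ← pow_succ]
    have h2 : Fintype.card K - 2 + 1 = Fintype.card K - 1 := by
      have := Fintype.one_lt_card (α := K)
      omega
    rw [h2, FiniteField.pow_card_sub_one_eq_one _ hn]
  refine Nat.find_min hex hnlt
    ⟨mono σ 0 (coef f n ^ (Fintype.card K - 2)) * f, I.mul_mem_left _ hf, ?_, fun k hk => ?_⟩
  · rw [coef_C_mul, map_mul, hinv]
  · rw [coef_C_mul, map_mul, hn' k hk, mul_zero]

end Local

/-! ### From points to the whole coefficient ring -/

section Global

variable {R K ι : Type*} [CommRing R] [Field K] [Finite K] [Finite ι] {σ : R →+* R}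
  {τ : ι → R →+* K}

/-- An element of `R` that is `1` at `τ i`, and `0` at every `τ j` with another kernel. -/
theorem exists_separating (τ : ι → R →+* K) (i : ι) :
    ∃ e : R, τ i e = 1 ∧
      ∀ j, τ j e = 0 ∨ τ j e = 1 ∧ ∀ r, τ j r = 0 ↔ τ i r = 0 := by
  classical
  have := Fintype.ofFinite K
  have := Fintype.ofFinite ι
  have hq : Fintype.card K - 1 ≠ 0 := by
    have := Fintype.one_lt_card (α := K)
    omega
  have hpair : ∀ j, ∃ e : R, τ i e = 1 ∧ (τ j e = 0 ∨ ∀ r, τ j r = 0 ↔ τ i r = 0) := by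
    intro j
    by_cases h : ∀ r, τ j r = 0 ↔ τ i r = 0
    · exact ⟨1, map_one _, Or.inr h⟩
    · push Not at h
      obtain ⟨r, ⟨hj, hi⟩ | ⟨hj, hi⟩⟩ := h
      · refine ⟨r ^ (Fintype.card K - 1), ?_, Or.inl ?_⟩
        · rw [map_pow, FiniteField.pow_card_sub_one_eq_one _ hi]
        · rw [map_pow, hj, zero_pow hq]
      · refine ⟨1 - r ^ (Fintype.card K - 1), ?_, Or.inl ?_⟩
        · rw [map_sub, map_one, map_pow, hi, zero_pow hq, sub_zero]
        · rw [map_sub, map_one, map_pow, FiniteField.pow_card_sub_one_eq_one _ hj, sub_self]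
  choose e he1 he2 using hpair
  have hi : τ i (∏ j, e j) = 1 := by
    rw [map_prod]
    exact Finset.prod_eq_one fun j _ => he1 j
  refine ⟨∏ j, e j, hi, fun j => ?_⟩
  rcases he2 j with h | h
  · left
    rw [map_prod]
    exact Finset.prod_eq_zero (Finset.mem_univ j) h
  · right
    have h1 := (h (∏ j, e j - 1)).mpr (by rw [map_sub, hi, map_one, sub_self])
    rw [map_sub, map_one, sub_eq_zero] at h1
    exact ⟨h1, h⟩

/-- Membership in a left ideal is a local condition: the scalars that multiply `f` into `J` form an
ideal of `R`, which contains an element equal to `1` at each point, hence contains `1`. -/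
theorem mem_of_forall_congr (hinj : ∀ r, (∀ i, τ i r = 0) → r = 0) (J : Ideal (SkewPoly R σ))
    {f : SkewPoly R σ} (h : ∀ i, ∃ j ∈ J, DegLT (τ i) (f - j) 0) : f ∈ J := by
  have := Fintype.ofFinite ι
  let A : Ideal R :=
    { carrier := {s | mono σ 0 s * f ∈ J}
      zero_mem' := by simp
      add_mem' := fun {a b} ha hb => by
        simp only [Set.mem_ofPred_eq, mono_add, add_mul] at ha hb ⊢
        exact J.add_mem ha hb
      smul_mem' := fun c a ha => by
        have hc : mono σ 0 (c * a) = mono σ 0 c * mono σ 0 a := by simp [mono_mul_mono]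
        simp only [Set.mem_ofPred_eq, smul_eq_mul] at ha ⊢
        rw [hc, mul_assoc]
        exact J.mul_mem_left _ ha }
  have hA : ∀ i, ∃ e ∈ A, τ i e = 1 := by
    intro i
    obtain ⟨e, he, hej⟩ := exists_separating τ i
    obtain ⟨j, hj, hfj⟩ := h i
    refine ⟨e, ?_, he⟩
    have heq : mono σ 0 e * f = mono σ 0 e * j := by
      refine eq_of_forall_coef hinj fun k n hn => ?_
      rw [← mul_sub, coef_C_mul, map_mul]
      rcases hej k with h0 | ⟨_, h1⟩
      · rw [h0, zero_mul]
      · rw [(h1 _).mpr (hfj n hn), mul_zero]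
    change mono σ 0 e * f ∈ J
    rw [heq]
    exact J.mul_mem_left _ hj
  choose e heA he1 using hA
  -- This product vanishes at every point, and it is congruent to `1` modulo `A`.
  have hprod : ∏ i, (1 - e i) = 0 := hinj _ fun i => by
    rw [map_prod]
    exact Finset.prod_eq_zero (Finset.mem_univ i) (by rw [map_sub, map_one, he1, sub_self])
  have h1 : (1 : R) ∈ A := by
    rw [← Ideal.Quotient.eq_zero_iff_mem, map_one, ← map_zero (Ideal.Quotient.mk A), ← hprod,
      map_prod]
    refine (Finset.prod_eq_one fun i _ => ?_).symm
    rw [map_sub, map_one, Ideal.Quotient.eq_zero_iff_mem.mpr (heA i), sub_zero]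
  have h2 : mono σ 0 1 * f ∈ J := h1
  rwa [mono_zero_one, one_mul] at h2

/-- Skew polynomials prescribed at every point glue, up to replacing a point by one with the same
kernel. -/
theorem exists_glue (g : ι → SkewPoly R σ) :
    ∃ f : SkewPoly R σ, ∀ i, ∃ j, (∀ r, τ i r = 0 ↔ τ j r = 0) ∧ DegLT (τ i) (f - g j) 0 := by
  classical
  have := Fintype.ofFinite ι
  suffices H : ∀ T : Finset ι, ∃ f : SkewPoly R σ, ∀ i ∈ T, ∃ j,
      (∀ r, τ i r = 0 ↔ τ j r = 0) ∧ DegLT (τ i) (f - g j) 0 by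
    obtain ⟨f, hf⟩ := H Finset.univ
    exact ⟨f, fun i => hf i (Finset.mem_univ i)⟩
  intro T
  induction T using Finset.induction_on with
  | empty => exact ⟨0, fun i hi => absurd hi (Finset.notMem_empty i)⟩
  | insert b T _ ih =>
    obtain ⟨f, hf⟩ := ih
    obtain ⟨e, he, hej⟩ := exists_separating τ b
    refine ⟨mono σ 0 e * g b + mono σ 0 (1 - e) * f, fun i hi => ?_⟩
    rcases hej i with h0 | ⟨h1, hker⟩
    · have hiT : i ∈ T := by
        refine (Finset.mem_insert.mp hi).resolve_left ?_
        rintro rfl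
        exact one_ne_zero (he.symm.trans h0)
      obtain ⟨j, hj, hfj⟩ := hf i hiT
      refine ⟨j, hj, fun n hn => ?_⟩
      have := hfj n hn
      simp only [coef_sub, coef_add, coef_C_mul, map_add, map_sub, map_mul, h0, map_one] at this ⊢
      linear_combination this
    · refine ⟨b, hker, fun n _ => ?_⟩
      simp only [coef_sub, coef_add, coef_C_mul, map_add, map_sub, map_mul, h1, map_one]
      ring

variable {σK : K →+* K}

/-- Every left ideal containing an element that is monic at every point is generated by an
element that is monic of least degree at every point. -/
theorem exists_leastMonic_generator (hinj : ∀ r, (∀ i, τ i r = 0) → r = 0)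
    {I : Ideal (SkewPoly R σ)} (hI : ∀ i, ∃ f ∈ I, ∃ d, MonicAt (τ i) f d) :
    ∃ g ∈ I, ∀ i, IsLeastMonicAt (τ i) I g := by
  choose g hgI hg using fun i => exists_isLeastMonicAt (hI i)
  obtain ⟨f, hf⟩ := exists_glue (τ := τ) g
  refine ⟨f, ?_, fun i => ?_⟩
  · exact mem_of_forall_congr hinj I fun i => by
      obtain ⟨j, _, hj⟩ := hf i
      exact ⟨g j, hgI j, hj⟩
  · obtain ⟨j, hker, hj⟩ := hf i
    obtain ⟨d, ⟨hd1, hd2⟩, hmin⟩ := hg j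
    have hfg : ∀ n, τ i (coef f n) = τ i (coef (g j) n) := fun n => by
      rw [← sub_eq_zero, ← map_sub, ← coef_sub]
      exact hj n (Nat.zero_le n)
    refine ⟨d, ⟨?_, fun n hn => ?_⟩, fun f' hf' hlt n hn => ?_⟩
    · have h1 : τ i (coef (g j) d - 1) = 0 :=
        (hker _).mpr (by rw [map_sub, hd1, map_one, sub_self])
      rw [map_sub, map_one, sub_eq_zero] at h1
      rw [hfg, h1]
    · rw [hfg, hker, hd2 n hn]
    · rw [hker]
      exact hmin f' hf' (fun k hk => (hker _).mp (hlt k hk)) n hn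

/-- A skew polynomial belongs to the left ideal of `g` if, at every point, its remainder in the
right division by `g` vanishes. -/
theorem mem_span_singleton_of_local (hτ : ∀ i r, τ i (σ r) = σK (τ i r))
    (hinj : ∀ r, (∀ i, τ i r = 0) → r = 0) {f g : SkewPoly R σ}
    (h : ∀ i, ∃ d, MonicAt (τ i) g d ∧
      ∀ u, DegLT (τ i) (f - u * g) d → DegLT (τ i) (f - u * g) 0) :
    f ∈ Ideal.span {g} :=
  mem_of_forall_congr hinj _ fun i => by
    obtain ⟨d, hd, hmin⟩ := h i
    obtain ⟨u, hu⟩ := exists_div_degLT (hτ i) hd f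
    exact ⟨u * g, Ideal.mem_span_singleton'.mpr ⟨u, rfl⟩, hmin u hu⟩

theorem eq_span_of_leastMonic (hτ : ∀ i r, τ i (σ r) = σK (τ i r))
    (hinj : ∀ r, (∀ i, τ i r = 0) → r = 0) {I : Ideal (SkewPoly R σ)} {g : SkewPoly R σ}
    (hgI : g ∈ I) (hg : ∀ i, IsLeastMonicAt (τ i) I g) : I = Ideal.span {g} := by
  refine le_antisymm (fun f hf => ?_) ((Ideal.span_singleton_le_iff_mem _).mpr hgI)
  refine mem_span_singleton_of_local hτ hinj fun i => ?_
  obtain ⟨d, hd, hmin⟩ := hg i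
  exact ⟨d, hd, fun u => hmin _ (I.sub_mem hf (I.mul_mem_left u hgI))⟩

end Global

/-! ### Skew polynomials as linearized operators -/

section Operators

variable {R K : Type*} [CommRing R] [Field K] {σ : R →+* R} {σK : K →+* K} {τ : R →+* K}

/-- The operator `β ↦ ∑ τ(fₙ) σⁿ(β)` on `K` attached to `f = ∑ fₙ zⁿ`. -/
def skewOp (σK : K →+* K) (τ : R →+* K) : SkewPoly R σ →+ (K →+ K) :=
  (Finsupp.liftAddHom (M := Twisted R σ) (N := K →+ K)
      fun n : Multiplicative ℕ =>
        ({ toFun := fun r => (AddMonoidHom.mulLeft (τ r)).comp (σK ^ n.toAdd : K →+* K).toAddMonoidHom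
           map_zero' := by ext; simp
           map_add' := fun a b => by ext; simp [add_mul] } : R →+ (K →+ K))).comp
    (SkewMonoidAlgebra.coeffAddEquiv (k := Twisted R σ) (G := Multiplicative ℕ)).toAddMonoidHom

theorem skewOp_mono (n : ℕ) (a : R) (β : K) :
    skewOp σK τ (mono σ n a) β = τ a * (σK ^ n : K →+* K) β :=
  DFunLike.congr_fun (Finsupp.liftAddHom_apply_single (M := Twisted R σ) (N := K →+ K) _ _ _) β

theorem skewOp_mul (hτ : ∀ r, τ (σ r) = σK (τ r)) (f g : SkewPoly R σ) (β : K) :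
    skewOp σK τ (f * g) β = skewOp σK τ f (skewOp σK τ g β) := by
  induction f using SkewPoly.induction with
  | h0 => simp
  | hm n a =>
    induction g using SkewPoly.induction with
    | h0 => simp
    | hm k b =>
      rw [mono_mul_mono, skewOp_mono, skewOp_mono, skewOp_mono, map_mul, apply_iterate hτ, map_mul,
        pow_add, RingHom.mul_def, RingHom.comp_apply, mul_assoc]
    | hadd f g hf hg => simp only [mul_add, map_add, AddMonoidHom.add_apply, hf, hg]
  | hadd f g hf hg => simp only [add_mul, map_add, AddMonoidHom.add_apply, hf, hg]

theorem skewOp_eq_sum {f : SkewPoly R σ} {N : ℕ} (hf : DegLT τ f N) (β : K) :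
    skewOp σK τ f β = ∑ n ∈ Finset.range N, τ (coef f n) * (σK ^ n : K →+* K) β := by
  have H : ∀ f : SkewPoly R σ, ∃ M₀, ∀ M, M₀ ≤ M →
      skewOp σK τ f β = ∑ n ∈ Finset.range M, τ (coef f n) * (σK ^ n : K →+* K) β := by
    intro f
    induction f using SkewPoly.induction with
    | h0 => exact ⟨0, fun M _ => by simp⟩
    | hm n a =>
      refine ⟨n + 1, fun M hM => ?_⟩
      rw [skewOp_mono, Finset.sum_eq_single n]
      · rw [coef_mono, if_pos rfl]
      · intro k _ hk
        rw [coef_mono, if_neg hk.symm, map_zero, zero_mul]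
      · intro h
        exact absurd (Finset.mem_range.mpr hM) h
    | hadd f g hf hg =>
      obtain ⟨A, hA⟩ := hf
      obtain ⟨B, hB⟩ := hg
      refine ⟨max A B, fun M hM => ?_⟩
      rw [map_add, AddMonoidHom.add_apply, hA M (by omega), hB M (by omega),
        ← Finset.sum_add_distrib]
      exact Finset.sum_congr rfl fun n _ => by rw [coef_add, map_add, add_mul]
  obtain ⟨M₀, hM₀⟩ := H f
  rw [hM₀ (max M₀ N) (le_max_left _ _)]
  refine (Finset.sum_subset (Finset.range_mono (le_max_right _ _)) fun n _ hn => ?_).symm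
  rw [hf n (by simpa using hn), zero_mul]

variable {q : ℕ}

theorem iterate_eq_pow (hσK : ∀ x, σK x = x ^ q) (n : ℕ) (x : K) :
    (σK ^ n : K →+* K) x = x ^ q ^ n := by
  induction n with
  | zero => simp
  | succ n ih => rw [pow_succ', RingHom.mul_def, RingHom.comp_apply, ih, hσK, ← pow_mul, pow_succ]

/-- The operator of a skew polynomial of degree `d` is evaluation of an ordinary polynomial of
degree `q ^ d`, so its kernel has at most `q ^ d` elements. -/
theorem card_ker_skewOp_le (hq : 1 < q) (hσK : ∀ x, σK x = x ^ q) {f : SkewPoly R σ} {d : ℕ}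
    (hd : τ (coef f d) ≠ 0) (hlt : DegLT τ f (d + 1)) :
    Nat.card (skewOp σK τ f).ker ≤ q ^ d := by
  classical
  let P : K[X] := ∑ n ∈ Finset.range (d + 1), C (τ (coef f n)) * X ^ q ^ n
  have hP0 : P ≠ 0 := by
    intro h0
    apply hd
    have hc : P.coeff (q ^ d) = τ (coef f d) := by
      simp only [P, finsetSum_coeff, coeff_C_mul, coeff_X_pow]
      rw [Finset.sum_eq_single d]
      · simp
      · intro n _ hn
        rw [if_neg fun h => hn (Nat.pow_right_injective hq h).symm, mul_zero]
      · intro h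
        exact absurd (Finset.self_mem_range_succ d) h
    rw [← hc, h0, coeff_zero]
  have hdeg : P.natDegree ≤ q ^ d :=
    natDegree_sum_le_of_forall_le _ _ fun n hn =>
      (natDegree_C_mul_X_pow_le _ _).trans
        (Nat.pow_le_pow_right hq.le (Nat.lt_succ_iff.mp (Finset.mem_range.mp hn)))
  have hsub : ((skewOp σK τ f).ker : Set K) ⊆ P.roots.toFinset := by
    intro β hβ
    rw [SetLike.mem_coe, AddMonoidHom.mem_ker, skewOp_eq_sum hlt] at hβ
    rw [Finset.mem_coe, Multiset.mem_toFinset, mem_roots hP0, IsRoot.def, eval_finsetSum, ← hβ]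
    exact Finset.sum_congr rfl fun n _ => by
      rw [eval_mul, eval_C, eval_pow, eval_X, iterate_eq_pow hσK]
  calc Nat.card (skewOp σK τ f).ker = ((skewOp σK τ f).ker : Set K).ncard := rfl
    _ ≤ (P.roots.toFinset : Set K).ncard := Set.ncard_le_ncard hsub (Finset.finite_toSet _)
    _ ≤ P.natDegree := by
        rw [Set.ncard_coe_finset]
        exact (Multiset.toFinset_card_le _).trans (card_roots' P)
    _ ≤ q ^ d := hdeg

/-- If `g` right-divides `z ^ N - 1`, then its operator has as large a kernel as its degree `d`
allows, so no nonzero skew polynomial of smaller degree annihilates that kernel. -/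
theorem degLT_zero_of_ker_le (hτ : ∀ r, τ (σ r) = σK (τ r)) (hq : 1 < q)
    (hσK : ∀ x, σK x = x ^ q) {N d : ℕ} (hσN : σK ^ N = 1) (hK : Nat.card K = q ^ N)
    (hN : 0 < N) {g h r : SkewPoly R σ} (hhg : h * g = Z σ ^ N - 1) (hg : MonicAt τ g d)
    (hr : DegLT τ r d) (hker : ∀ β, skewOp σK τ g β = 0 → skewOp σK τ r β = 0) :
    DegLT τ r 0 := by
  have hfin : Finite K := Nat.finite_of_card_ne_zero (by rw [hK]; positivity)
  by_contra h0
  obtain ⟨n, hn, hlt⟩ := exists_leading h0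
  have hnd : n < d := by
    by_contra hle
    exact hn (hr n (by omega))
  obtain ⟨k, hkd, hk⟩ := MonicAt.left_of_mul hτ hg
    (by rw [hhg]; exact monicAt_Z_pow_sub_one hN)
  -- These bounds contradict `q ^ (k + d) = |K| = |ker g| |range g|`, as `range g` lies in `ker h`.
  have hkerg : Nat.card (skewOp σK τ g).ker ≤ q ^ n :=
    (Nat.card_le_card_of_injective (AddSubgroup.inclusion (fun β hβ => hker β hβ))
      (AddSubgroup.inclusion_injective _)).trans (card_ker_skewOp_le hq hσK hn hlt)
  have hrange : Nat.card (skewOp σK τ g).range ≤ q ^ k := by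
    refine (Nat.card_le_card_of_injective (AddSubgroup.inclusion ?_)
      (AddSubgroup.inclusion_injective _)).trans
        (card_ker_skewOp_le (f := h) hq hσK (hk.1.trans_ne one_ne_zero) hk.2)
    rintro _ ⟨β, rfl⟩
    rw [AddMonoidHom.mem_ker, ← skewOp_mul hτ, hhg, Z_pow, ← mono_zero_one, map_sub,
      AddMonoidHom.sub_apply, skewOp_mono, skewOp_mono, hσN, pow_zero, sub_self]
  have hcard := AddSubgroup.card_mul_index (skewOp σK τ g).ker
  rw [AddSubgroup.index_ker, hK] at hcard
  have hle : q ^ N ≤ q ^ (n + k) := by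
    rw [← hcard, pow_add]
    exact Nat.mul_le_mul hkerg hrange
  have := (Nat.pow_le_pow_iff_right hq).mp hle
  omega

end Operators

end SkewPoly

open SkewPoly

/-! ### The evaluations of `𝒮` at the roots of `x ^ ℓ - 1` -/

section Points

variable {F E K : Type*} [Field F] [Field E] [Field K] [Algebra F K] [Algebra E K] {ℓ : ℕ}

/-- The evaluation of `𝒮 = F[x]/(x ^ ℓ - 1)` at a root of `x ^ ℓ - 1` in `E`, with values in a
common extension `K` of `F` and `E`. -/
def point (F K : Type*) [Field F] [Field K] [Algebra F K] [Algebra E K]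
    (a : {a : E // a ^ ℓ = 1}) : S F ℓ →+* K :=
  evA F (algebraMap E K a) (map_pow_eq_one a.2)

theorem point_mk (a : {a : E // a ^ ℓ = 1}) (f : F[X]) :
    point F K a (AdjoinRoot.mk _ f) = aeval (algebraMap E K a) f :=
  AdjoinRoot.lift_mk (by simp [map_pow_eq_one a.2]) f

theorem point_sigmaS {σF : F →+* F} {σK : K →+* K}
    (hσ : ∀ x, algebraMap F K (σF x) = σK (algebraMap F K x))
    (hE : ∀ a : E, σK (algebraMap E K a) = algebraMap E K a) (a : {a : E // a ^ ℓ = 1})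
    (r : S F ℓ) : point F K a (sigmaS σF ℓ r) = σK (point F K a r) := by
  suffices h : (point F K a).comp (sigmaS σF ℓ) = σK.comp (point F K a) from
    RingHom.congr_fun h r
  refine AdjoinRoot.ringHom_ext ?_ ?_
  · ext x
    simp [point, sigmaS, evA, hσ]
  · simp [point, sigmaS, evA, hE]

theorem splits_map_X_pow_sub_one (hroots : (X ^ ℓ - 1 : E[X]).Splits) :
    (X ^ ℓ - 1 : K[X]).Splits := by
  have h := hroots.map (algebraMap E K)
  simpa using h

theorem exists_algebraMap_eq (hroots : (X ^ ℓ - 1 : E[X]).Splits) (hℓ : ℓ ≠ 0) {b : K}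
    (hb : b ^ ℓ = 1) :
    ∃ a : E, a ^ ℓ = 1 ∧ algebraMap E K a = b := by
  have h := hroots.roots_map (algebraMap E K)
  have hne : ((X ^ ℓ - 1 : E[X]).map (algebraMap E K)) ≠ 0 := by
    simpa using X_pow_sub_C_ne_zero (Nat.pos_of_ne_zero hℓ) (1 : K)
  have hmem : b ∈ ((X ^ ℓ - 1 : E[X]).map (algebraMap E K)).roots := by
    rw [mem_roots hne]
    simp [hb]
  rw [h, Multiset.mem_map] at hmem
  obtain ⟨a, ha, rfl⟩ := hmem
  have := isRoot_of_mem_roots ha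
  exact ⟨a, by simpa [sub_eq_zero] using this, rfl⟩

/-- Since `x ^ ℓ - 1` has `ℓ` distinct roots, an element of `𝒮` is determined by its values at
them. -/
theorem eq_zero_of_point_eq_zero (hroots : (X ^ ℓ - 1 : E[X]).Splits) (hℓ : (ℓ : K) ≠ 0)
    (r : S F ℓ)
    (hr : ∀ a : {a : E // a ^ ℓ = 1}, point F K a r = 0) : r = 0 := by
  obtain ⟨f, rfl⟩ := AdjoinRoot.mk_surjective r
  have hℓ0 : ℓ ≠ 0 := by
    rintro rfl
    exact hℓ Nat.cast_zero
  rw [AdjoinRoot.mk_eq_zero]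
  by_cases hf : f = 0
  · rw [hf]
    exact dvd_zero _
  rw [← map_dvd_map' (algebraMap F K)]
  have hmap : (X ^ ℓ - 1 : F[X]).map (algebraMap F K) = X ^ ℓ - 1 := by simp
  have hne : (X ^ ℓ - 1 : K[X]) ≠ 0 := by
    simpa using X_pow_sub_C_ne_zero (Nat.pos_of_ne_zero hℓ0) (1 : K)
  have hf' : f.map (algebraMap F K) ≠ 0 := by
    rwa [Ne, Polynomial.map_eq_zero]
  rw [hmap]
  refine (splits_map_X_pow_sub_one hroots).dvd_of_roots_le_roots hne ?_
  rw [Multiset.le_iff_subset (nodup_roots (X_pow_sub_one_separable_iff.mpr hℓ))]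
  intro b hb
  have hb1 : b ^ ℓ = 1 := by
    have := isRoot_of_mem_roots hb
    simpa [sub_eq_zero] using this
  obtain ⟨a, ha, rfl⟩ := exists_algebraMap_eq hroots hℓ0 hb1
  have := hr ⟨a, ha⟩
  rw [point_mk] at this
  rw [mem_roots hf', IsRoot.def, eval_map_algebraMap, this]

/-- If `a` is a root of the irreducible factor `P`, then `F[x]/(P)` embeds into `K` by evaluation
at `a`. -/
theorem point_eq_zero_iff_projS {P : F[X]} (hP : P ∣ X ^ ℓ - 1) (hirr : Irreducible P)
    (a : {a : E // a ^ ℓ = 1}) (ha : aeval (algebraMap E K a) P = 0) (r : S F ℓ) :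
    point F K a r = 0 ↔ projS hP r = 0 := by
  have := Fact.mk hirr
  have ha' : eval₂ (algebraMap F K) (algebraMap E K a) P = 0 := ha
  obtain ⟨f, rfl⟩ := AdjoinRoot.mk_surjective r
  have h1 : point F K a (AdjoinRoot.mk _ f)
      = AdjoinRoot.lift (algebraMap F K) (algebraMap E K a) ha' (projS hP (AdjoinRoot.mk _ f)) := by
    have h2 : projS hP (AdjoinRoot.mk _ f) = AdjoinRoot.mk P f := by
      rw [projS, AdjoinRoot.map, AdjoinRoot.lift_mk, RingHom.comp_id, ← AdjoinRoot.aeval_eq,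
        aeval_def, AdjoinRoot.algebraMap_eq]
    rw [point_mk, h2, AdjoinRoot.lift_mk, aeval_def]
  rw [h1, map_eq_zero]

theorem point_eq_one_iff_projS {P : F[X]} (hP : P ∣ X ^ ℓ - 1) (hirr : Irreducible P)
    (a : {a : E // a ^ ℓ = 1}) (ha : aeval (algebraMap E K a) P = 0) (r : S F ℓ) :
    point F K a r = 1 ↔ projS hP r = 1 := by
  rw [← sub_eq_zero, ← map_one (point F K a), ← map_sub, point_eq_zero_iff_projS hP hirr a ha,
    map_sub, map_one, sub_eq_zero]

/-- The irreducible factors of `x ^ ℓ - 1` over `F` are the minimal polynomials of its roots, so being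
monic modulo each factor amounts to being monic at each root. -/
theorem isComponentwiseMonic_iff (hroots : (X ^ ℓ - 1 : E[X]).Splits) (hℓ : ℓ ≠ 0)
    {σF : F →+* F} {f : Sz σF ℓ} :
    IsComponentwiseMonic f ↔
      ∀ a : {a : E // a ^ ℓ = 1}, ∃ d, MonicAt (point F K a) f d := by
  have hiff : ∀ {P : F[X]} (hP : P ∣ X ^ ℓ - 1), Irreducible P →
      ∀ a : {a : E // a ^ ℓ = 1}, aeval (algebraMap E K a) P = 0 →
      ((∃ d : ℕ, projS hP (coef f d) = 1 ∧ ∀ n, d < n → projS hP (coef f n) = 0) ↔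
        ∃ d, MonicAt (point F K a) f d) := by
    intro P hP hirr a ha
    simp only [MonicAt, DegLT, point_eq_one_iff_projS hP hirr a ha,
      point_eq_zero_iff_projS hP hirr a ha, Nat.succ_le_iff]
  constructor
  · intro h a
    have hroot : aeval (algebraMap E K a) (X ^ ℓ - 1 : F[X]) = 0 := by
      simp [map_pow_eq_one a.2]
    have hint : IsIntegral F (algebraMap E K a) :=
      ⟨X ^ ℓ - 1, by simpa using monic_X_pow_sub_C (1 : F) hℓ, hroot⟩
    exact (hiff (minpoly.dvd F _ hroot) (minpoly.irreducible hint) a (minpoly.aeval F _)).mp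
      (h _ _ (minpoly.irreducible hint))
  · intro h P hP hirr
    have hne : (X ^ ℓ - 1 : K[X]) ≠ 0 := by
      simpa using X_pow_sub_C_ne_zero (Nat.pos_of_ne_zero hℓ) (1 : K)
    have hdvd : P.map (algebraMap F K) ∣ X ^ ℓ - 1 := by
      have := Polynomial.map_dvd (algebraMap F K) hP
      simpa using this
    obtain ⟨b, hb⟩ := ((splits_map_X_pow_sub_one hroots).of_dvd hne hdvd).exists_eval_eq_zero
      (by rw [degree_map]; exact hirr.degree_pos.ne')
    have hb1 : b ^ ℓ = 1 := by
      have := eval_eq_zero_of_dvd_of_eval_eq_zero hdvd hb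
      simpa [sub_eq_zero] using this
    obtain ⟨a, ha, rfl⟩ := exists_algebraMap_eq hroots hℓ hb1
    rw [eval_map_algebraMap] at hb
    exact (hiff hP hirr ⟨a, ha⟩ hb).mpr (h ⟨a, ha⟩)

/-- The total evaluation at `(a, β)` is, up to the unit `β`, the value at `β` of the operator of
`c(a, z)`. -/
theorem totalEval_toQuot {m : ℕ} (σF : F →+* F) (σK : K →+* K) [Fact (σK ^ m = 1)] (a : K)
    (ha : a ^ ℓ = 1) (β : Kˣ) (f : Sz σF ℓ) :
    totalEval σF σK a ha β (toQuot m f)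
      = skewOp σK (evA F a ha) f (β : K) * (β : K)⁻¹ := by
  have h : totalEval σF σK a ha β (toQuot m f)
      = remHom σK (conjOne σK β) (SkewPoly.map σK (evA F a ha) f) :=
    eval_eq_remHom _ _
  rw [h]
  clear h
  induction f using SkewPoly.induction with
  | h0 => simp
  | hm n b => rw [map_mono, remHom_mono, normAt_conjOne, skewOp_mono, mul_assoc]
  | hadd f g hf hg => rw [map_add, map_add, hf, hg, map_add, AddMonoidHom.add_apply, add_mul]

theorem totalEval_toQuot_eq_zero_iff {m : ℕ} (σF : F →+* F) (σK : K →+* K) [Fact (σK ^ m = 1)]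
    (a : K) (ha : a ^ ℓ = 1) (β : Kˣ) (f : Sz σF ℓ) :
    totalEval σF σK a ha β (toQuot m f) = 0 ↔ skewOp σK (evA F a ha) f (β : K) = 0 := by
  rw [totalEval_toQuot, mul_eq_zero_iff_right (inv_ne_zero β.ne_zero)]

end Points

/-! ### Codes as left ideals -/

section CodeIdeal

variable {F : Type*} [Field F] {ℓ m : ℕ}

theorem toQuot_mono_mod {R : Type*} [CommRing R] {σ : R →+* R} (k : ℕ) (r : R) :
    toQuot m (mono σ (k % m) r) = toQuot m (mono σ k r) := by
  have hstep : ∀ n, toQuot m (mono σ (n + m) r) = toQuot m (mono σ n r) := fun n => by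
    refine (Submodule.Quotient.eq _).mpr (Ideal.mem_span_singleton'.mpr ⟨mono σ n r, ?_⟩)
    rw [mul_sub, mul_one, Z_pow, mono_mul_mono, map_one, mul_one]
  have hmul : ∀ t n, toQuot m (mono σ (n + m * t) r) = toQuot m (mono σ n r) := by
    intro t
    induction t with
    | zero => intro n; rfl
    | succ t ih => intro n; rw [mul_add, mul_one, ← add_assoc, hstep, ih]
  rw [← hmul (k / m), Nat.mod_add_div]

/-- The polynomial `∑ᵢ aᵢ xⁱ` of `𝒮` with a given vector of coefficients. -/
def blockPoly (a : Fin ℓ → F) : S F ℓ :=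
  ∑ i : Fin ℓ, AdjoinRoot.of _ (a i) * AdjoinRoot.root (X ^ ℓ - 1 : F[X]) ^ (i : ℕ)

/-- The representative `∑ⱼ (∑ᵢ c⁽ⁱ⁾ⱼ xⁱ) zʲ` of `ν(c)` of degree less than `m` in `z`. -/
def wordPoly (σ : F →+* F) (c : Fin ℓ → Fin m → F) : Sz σ ℓ :=
  ∑ j : Fin m, mono (sigmaS σ ℓ) j (blockPoly fun i => c i j)

theorem nu_eq (σ : F →+* F) (c : Fin ℓ → Fin m → F) : nu σ c = toQuot m (wordPoly σ c) := rfl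

theorem blockPoly_add (a b : Fin ℓ → F) :
    blockPoly (fun i => a i + b i) = blockPoly a + blockPoly b := by
  simp [blockPoly, add_mul, Finset.sum_add_distrib]

theorem of_mul_blockPoly (t : F) (a : Fin ℓ → F) :
    AdjoinRoot.of _ t * blockPoly a = blockPoly fun i => t * a i := by
  simp [blockPoly, Finset.mul_sum, mul_assoc]

theorem sigmaS_blockPoly (σ : F →+* F) (a : Fin ℓ → F) :
    sigmaS σ ℓ (blockPoly a) = blockPoly fun i => σ (a i) := by
  simp [blockPoly, sigmaS]

theorem root_mul_blockPoly [NeZero ℓ] (a : Fin ℓ → F) :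
    AdjoinRoot.root (X ^ ℓ - 1 : F[X]) * blockPoly a = blockPoly fun i => a (i - 1) := by
  have hroot : AdjoinRoot.root (X ^ ℓ - 1 : F[X]) ^ ℓ = 1 := by
    have := AdjoinRoot.eval₂_root (X ^ ℓ - 1 : F[X])
    simpa [sub_eq_zero] using this
  rw [blockPoly, blockPoly, Finset.mul_sum, ← Equiv.sum_comp (Equiv.addRight (1 : Fin ℓ))
    (fun i => AdjoinRoot.of (X ^ ℓ - 1 : F[X]) (a (i - 1)) * AdjoinRoot.root _ ^ (i : ℕ))]
  refine Finset.sum_congr rfl fun i _ => ?_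
  have hval : ((i + 1 : Fin ℓ) : ℕ) = ((i : ℕ) + 1) % ℓ := by
    rw [Fin.val_add, Fin.val_one', Nat.add_mod_mod]
  simp only [Equiv.coe_addRight]
  rw [add_sub_cancel_right, hval, ← pow_eq_pow_mod _ hroot]
  ring

theorem blockPoly_injective (hℓ : ℓ ≠ 0) : Function.Injective (blockPoly (F := F) (ℓ := ℓ)) := by
  intro a b hab
  have hmk : ∀ a : Fin ℓ → F,
      blockPoly a = AdjoinRoot.mk _ (∑ i : Fin ℓ, C (a i) * X ^ (i : ℕ)) := fun a => by
    simp [blockPoly]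
  have hmonic : (X ^ ℓ - 1 : F[X]).Monic := by simpa using monic_X_pow_sub_C (1 : F) hℓ
  have hdeg : (X ^ ℓ - 1 : F[X]).degree = ℓ := by
    simpa using degree_X_pow_sub_C (Nat.pos_of_ne_zero hℓ) (1 : F)
  rw [hmk, hmk, ← sub_eq_zero, ← map_sub, AdjoinRoot.mk_eq_zero] at hab
  have hzero := eq_zero_of_dvd_of_degree_lt hab (by
    rw [hdeg]
    exact (degree_sub_le _ _).trans_lt (max_lt (degree_sum_fin_lt a) (degree_sum_fin_lt b)))
  have hco : ∀ (a : Fin ℓ → F) (i : Fin ℓ),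
      (∑ i : Fin ℓ, C (a i) * X ^ (i : ℕ)).coeff (i : ℕ) = a i := by
    intro a i
    simp [finsetSum_coeff, coeff_X_pow, Fin.val_inj]
  funext i
  rw [← hco a i, ← hco b i, sub_eq_zero.mp hzero]

theorem coef_wordPoly (σ : F →+* F) (c : Fin ℓ → Fin m → F) (n : ℕ) :
    coef (wordPoly σ c) n = if h : n < m then blockPoly (fun i => c i ⟨n, h⟩) else 0 := by
  have hsum : ∀ (s : Finset (Fin m)) (f : Fin m → Sz σ ℓ),
      coef (∑ j ∈ s, f j) n = ∑ j ∈ s, coef (f j) n := fun s f =>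
    map_sum ({ toFun := fun g => coef g n, map_zero' := rfl, map_add' := fun f g => coef_add f g n } :
      Sz σ ℓ →+ S F ℓ) f s
  rw [wordPoly, hsum]
  simp only [coef_mono]
  split_ifs with h
  · rw [Finset.sum_eq_single ⟨n, h⟩]
    · rw [if_pos rfl]
    · intro j _ hj
      rw [if_neg fun h' => hj (Fin.ext h')]
    · simp
  · exact Finset.sum_eq_zero fun j _ => if_neg fun h' : (j : ℕ) = n => h (h' ▸ j.2)

theorem nu_zero (σ : F →+* F) : nu σ (0 : Fin ℓ → Fin m → F) = 0 := by
  simp [nu]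

theorem nu_add (σ : F →+* F) (c d : Fin ℓ → Fin m → F) : nu σ (c + d) = nu σ c + nu σ d := by
  rw [nu_eq, nu_eq, nu_eq, ← Submodule.Quotient.mk_add]
  congr 1
  rw [wordPoly, wordPoly, wordPoly, ← Finset.sum_add_distrib]
  exact Finset.sum_congr rfl fun j _ => by
    rw [← mono_add, ← blockPoly_add]
    rfl

theorem C_smul_nu (σ : F →+* F) (r : S F ℓ) (c d : Fin ℓ → Fin m → F)
    (h : ∀ j, r * blockPoly (fun i => c i j) = blockPoly fun i => d i j) :
    mono (sigmaS σ ℓ) 0 r • nu σ c = nu σ d := by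
  rw [nu_eq, nu_eq, ← Submodule.Quotient.mk_smul, smul_eq_mul]
  congr 1
  rw [wordPoly, wordPoly, Finset.mul_sum]
  exact Finset.sum_congr rfl fun j _ => by
    rw [mono_mul_mono, zero_add, pow_zero, RingHom.one_def, RingHom.id_apply, h]

theorem Z_smul_nu [NeZero m] (σ : F →+* F) (c : Fin ℓ → Fin m → F) :
    Z (sigmaS σ ℓ) • nu σ c = nu σ (intraShift σ c) := by
  have hmk : ∀ f : Fin m → Sz σ ℓ, toQuot m (∑ j, f j) = ∑ j, toQuot m (f j) := fun f =>
    map_sum (Submodule.mkQ (zIdeal (S F ℓ) (sigmaS σ ℓ) m)) f Finset.univ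
  rw [nu_eq, nu_eq, ← Submodule.Quotient.mk_smul, smul_eq_mul, wordPoly, wordPoly, Finset.mul_sum]
  refine (hmk _).trans ?_
  rw [hmk, ← Equiv.sum_comp (Equiv.addRight (1 : Fin m))
    (fun j => toQuot m (mono (sigmaS σ ℓ) j (blockPoly fun i => intraShift σ c i j)))]
  refine Finset.sum_congr rfl fun j _ => ?_
  have hval : ((j + 1 : Fin m) : ℕ) = ((j : ℕ) + 1) % m := by
    rw [Fin.val_add, Fin.val_one', Nat.add_mod_mod]
  rw [Z, mono_mul_mono, pow_one, one_mul, sigmaS_blockPoly, Equiv.coe_addRight, hval,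
    toQuot_mono_mod, add_comm]
  simp only [intraShift, add_sub_cancel_right]

theorem smul_mem_codeInR [NeZero ℓ] [NeZero m] {σ : F →+* F}
    {C : Submodule F (Fin ℓ → Fin m → F)} (hC : IsCSC σ C) (f : Sz σ ℓ) {v : RR σ ℓ m}
    (hv : v ∈ codeInR σ C) : f • v ∈ codeInR σ C := by
  have hadd : ∀ {u v : RR σ ℓ m}, u ∈ codeInR σ C → v ∈ codeInR σ C → u + v ∈ codeInR σ C := by
    rintro _ _ ⟨c, hc, rfl⟩ ⟨d, hd, rfl⟩
    exact ⟨c + d, C.add_mem hc hd, nu_add σ c d⟩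
  have hzero : (0 : RR σ ℓ m) ∈ codeInR σ C := ⟨0, C.zero_mem, nu_zero σ⟩
  have hof : ∀ (t : F) {v : RR σ ℓ m}, v ∈ codeInR σ C →
      mono (sigmaS σ ℓ) 0 (AdjoinRoot.of _ t) • v ∈ codeInR σ C := by
    rintro t _ ⟨c, hc, rfl⟩
    exact ⟨t • c, C.smul_mem t hc, (C_smul_nu σ _ c _ fun j => of_mul_blockPoly t _).symm⟩
  have hroot : ∀ {v : RR σ ℓ m}, v ∈ codeInR σ C →
      mono (sigmaS σ ℓ) 0 (AdjoinRoot.root _) • v ∈ codeInR σ C := by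
    rintro _ ⟨c, hc, rfl⟩
    exact ⟨interShift c, hC.inter c hc, (C_smul_nu σ _ c _ fun j => root_mul_blockPoly _).symm⟩
  have hZ : ∀ (n : ℕ) {v : RR σ ℓ m}, v ∈ codeInR σ C →
      Z (sigmaS σ ℓ) ^ n • v ∈ codeInR σ C := by
    intro n
    induction n with
    | zero => intro v hv; rwa [pow_zero, one_smul]
    | succ n ih =>
      intro v hv
      obtain ⟨c, hc, rfl⟩ := hv
      rw [pow_succ, mul_smul, Z_smul_nu]
      exact ih ⟨_, hC.intra c hc, rfl⟩
  have hS : ∀ (r : S F ℓ) {v : RR σ ℓ m}, v ∈ codeInR σ C →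
      mono (sigmaS σ ℓ) 0 r • v ∈ codeInR σ C := by
    intro r
    obtain ⟨f, rfl⟩ := AdjoinRoot.mk_surjective r
    induction f using Polynomial.induction_on with
    | C a => exact fun hv => hof a hv
    | add f g hf hg =>
      intro v hv
      rw [map_add, mono_add, add_smul]
      exact hadd (hf hv) (hg hv)
    | monomial n a ih =>
      intro v hv
      have h : mono (sigmaS σ ℓ) 0 (AdjoinRoot.mk (X ^ ℓ - 1 : F[X]) (Polynomial.C a * X ^ (n + 1)))
          = mono (sigmaS σ ℓ) 0 (AdjoinRoot.root _)
            * mono (sigmaS σ ℓ) 0 (AdjoinRoot.mk _ (Polynomial.C a * X ^ n)) := by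
        rw [mono_mul_mono, zero_add, pow_zero, RingHom.one_def, RingHom.id_apply,
          ← AdjoinRoot.mk_X, ← map_mul]
        congr 2
        ring
      rw [h, mul_smul]
      exact hroot (ih hv)
  induction f using SkewPoly.induction with
  | h0 => rwa [zero_smul]
  | hm n r =>
    have h : mono (sigmaS σ ℓ) n r = mono (sigmaS σ ℓ) 0 r * Z (sigmaS σ ℓ) ^ n := by
      rw [Z_pow, mono_mul_mono, zero_add, map_one, mul_one]
    rw [h, mul_smul]
    exact hS r (hZ n hv)
  | hadd f g hf hg =>
    rw [add_smul]
    exact hadd hf hg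

/-- The left ideal of all skew polynomials whose class lies in the cyclic-skew-cyclic code `C`. -/
def codeIdeal [NeZero ℓ] [NeZero m] {σ : F →+* F} {C : Submodule F (Fin ℓ → Fin m → F)}
    (hC : IsCSC σ C) : Ideal (Sz σ ℓ) where
  carrier := {f | toQuot m f ∈ codeInR σ C}
  zero_mem' := ⟨0, C.zero_mem, nu_zero σ⟩
  add_mem' := by
    rintro f g ⟨c, hc, hf⟩ ⟨d, hd, hg⟩
    exact ⟨c + d, C.add_mem hc hd, by rw [nu_add, hf, hg]; rfl⟩
  smul_mem' f _ hg := smul_mem_codeInR hC f hg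

theorem mem_codeIdeal [NeZero ℓ] [NeZero m] {σ : F →+* F} {C : Submodule F (Fin ℓ → Fin m → F)}
    (hC : IsCSC σ C) {f : Sz σ ℓ} : f ∈ codeIdeal hC ↔ toQuot m f ∈ codeInR σ C := Iff.rfl

theorem Z_pow_sub_one_mem_codeIdeal [NeZero ℓ] [NeZero m] {σ : F →+* F}
    {C : Submodule F (Fin ℓ → Fin m → F)} (hC : IsCSC σ C) :
    Z (sigmaS σ ℓ) ^ m - 1 ∈ codeIdeal hC := by
  exact ⟨0, C.zero_mem, (nu_zero σ).trans
    ((Submodule.Quotient.mk_eq_zero _).mpr (Ideal.mem_span_singleton_self _)).symm⟩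

theorem toQuot_mem_span_iff {σ : F →+* F} [Fact (σ ^ m = 1)] {f g h : Sz σ ℓ}
    (hhg : h * g = Z (sigmaS σ ℓ) ^ m - 1) :
    toQuot m f ∈ (Ideal.span {toQuot m g} : Ideal (RR σ ℓ m)) ↔
      f ∈ (Ideal.span {g} : Ideal (Sz σ ℓ)) := by
  rw [Ideal.mem_span_singleton', Ideal.mem_span_singleton']
  constructor
  · rintro ⟨a, ha⟩
    obtain ⟨u, rfl⟩ := Submodule.Quotient.mk_surjective _ a
    obtain ⟨w, hw⟩ := Ideal.mem_span_singleton'.mp ((Submodule.Quotient.eq _).mp ha.symm)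
    refine ⟨u + w * h, ?_⟩
    rw [add_mul, mul_assoc w, hhg, hw]
    simp
  · rintro ⟨u, rfl⟩
    exact ⟨toQuot m u, rfl⟩

/-- The classes of two words agree only if the words do: their representatives have degree less
than `m` in `z`. -/
theorem nu_injective {E K : Type*} [Field E] [Field K] [Algebra F K] [Algebra E K] [NeZero ℓ]
    [NeZero m] {σF : F →+* F} {σK : K →+* K} (hroots : (X ^ ℓ - 1 : E[X]).Splits)
    (hℓ : (ℓ : K) ≠ 0) (hσ : ∀ x, algebraMap F K (σF x) = σK (algebraMap F K x))
    (hE : ∀ a : E, σK (algebraMap E K a) = algebraMap E K a) :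
    Function.Injective (nu σF : (Fin ℓ → Fin m → F) → RR σF ℓ m) := by
  intro c d hcd
  have hmem := (Submodule.Quotient.eq _).mp hcd
  have heq : wordPoly σF c = wordPoly σF d := by
    refine eq_of_forall_coef (eq_zero_of_point_eq_zero (F := F) hroots hℓ) fun a =>
      degLT_zero_of_mem_span (point_sigmaS hσ hE a) (monicAt_Z_pow_sub_one (NeZero.pos m)) hmem
        fun n hn => ?_
    rw [coef_sub, coef_wordPoly, coef_wordPoly, dif_neg (by omega), dif_neg (by omega), sub_zero,
      map_zero]
  funext i j
  have hj := congrArg (fun f => coef f (j : ℕ)) heq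
  simp only [coef_wordPoly, j.2, dif_pos] at hj
  exact congrFun (blockPoly_injective (NeZero.ne ℓ) hj) i

theorem minimalGenerator_spec {σF : F →+* F} [Fact (σF ^ m = 1)]
    {C : Submodule F (Fin ℓ → Fin m → F)} (h : ∃ g, ∃ h, IsMinimalPair σF C g h) :
    ∃ k, IsMinimalPair σF C (minimalGenerator σF C) k := by
  rw [minimalGenerator, dif_pos h]
  exact h.choose_spec

end CodeIdeal

/-! ### The minimal generator and the defining set -/

section MinimalGenerator

variable {F : Type*} [Field F] {ℓ m : ℕ} [NeZero ℓ] [NeZero m] {σF : F →+* F}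
  [Fact (σF ^ m = 1)] {C : Submodule F (Fin ℓ → Fin m → F)}

/-- The left ideal of a code is generated, before passing to the quotient by `z ^ m - 1`, by its
minimal generator. -/
theorem IsMinimalPair.codeIdeal_eq (hC : IsCSC σF C) {g h : Sz σF ℓ}
    (hgh : IsMinimalPair σF C g h) : codeIdeal hC = Ideal.span {g} := by
  ext f
  rw [mem_codeIdeal, hgh.generates, SetLike.mem_coe, toQuot_mem_span_iff hgh.check_mul_gen]

variable {E K : Type*} [Field E] [Field K] [Algebra F K] [Algebra E K]
  {σK : K →+* K}

theorem exists_isMinimalPair [Finite E] [Finite K] (hroots : (X ^ ℓ - 1 : E[X]).Splits)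
    (hℓ : (ℓ : K) ≠ 0) (hσ : ∀ x, algebraMap F K (σF x) = σK (algebraMap F K x))
    (hE : ∀ a : E, σK (algebraMap E K a) = algebraMap E K a) (hC : IsCSC σF C) :
    ∃ g, ∃ h, IsMinimalPair σF C g h := by
  have hτ := point_sigmaS (ℓ := ℓ) hσ hE
  have hinj := eq_zero_of_point_eq_zero (F := F) hroots hℓ
  have hZ := Z_pow_sub_one_mem_codeIdeal hC
  have hm := NeZero.pos m
  obtain ⟨g, hgI, hg⟩ := exists_leastMonic_generator (τ := point F K) hinj (I := codeIdeal hC)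
    fun a => ⟨_, hZ, m, monicAt_Z_pow_sub_one hm⟩
  have hspan := eq_span_of_leastMonic hτ hinj hgI hg
  have hgm : ∀ a : {a : E // a ^ ℓ = 1}, ∃ d, MonicAt (point F K a) g d := fun a =>
    (hg a).imp fun d hd => hd.1
  rw [hspan] at hZ
  obtain ⟨h, hhg⟩ := Ideal.mem_span_singleton'.mp hZ
  refine ⟨g, h, (isComponentwiseMonic_iff (K := K) hroots (NeZero.ne ℓ)).mpr hgm,
    (isComponentwiseMonic_iff (K := K) hroots (NeZero.ne ℓ)).mpr fun a => ?_, ?_, ?_, hhg⟩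
  · obtain ⟨d, hd⟩ := hgm a
    obtain ⟨n, -, hn⟩ := MonicAt.left_of_mul (hτ a) hd
      (by rw [hhg]; exact monicAt_Z_pow_sub_one hm)
    exact ⟨n, hn⟩
  · ext v
    obtain ⟨f, rfl⟩ := Submodule.Quotient.mk_surjective _ v
    rw [SetLike.mem_coe]
    exact (mem_codeIdeal hC).symm.trans
      ((by rw [hspan] : f ∈ codeIdeal hC ↔ f ∈ Ideal.span {g}).trans
        (toQuot_mem_span_iff hhg).symm)
  · -- `z ^ m - 1` is central and `g` is cancellable on the right.
    refine eq_of_mul_eq_mul_right hτ hinj hgm ?_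
    rw [mul_assoc, hhg, mul_zN_comm]

theorem IsMinimalPair.unique (hroots : (X ^ ℓ - 1 : E[X]).Splits)
    (hℓ : (ℓ : K) ≠ 0) (hσ : ∀ x, algebraMap F K (σF x) = σK (algebraMap F K x))
    (hE : ∀ a : E, σK (algebraMap E K a) = algebraMap E K a) (hC : IsCSC σF C)
    {g g' h h' : Sz σF ℓ} (hg : IsMinimalPair σF C g h) (hg' : IsMinimalPair σF C g' h') :
    g = g' :=
  generator_unique (point_sigmaS hσ hE) (eq_zero_of_point_eq_zero hroots hℓ)
    ((isComponentwiseMonic_iff hroots (NeZero.ne ℓ)).mp hg.monic_gen)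
    ((isComponentwiseMonic_iff hroots (NeZero.ne ℓ)).mp hg'.monic_gen)
    ((hg.codeIdeal_eq hC).symm.trans (hg'.codeIdeal_eq hC))

/-- A code consists of the elements that vanish wherever its minimal generator does. -/
theorem IsMinimalPair.mem_codeInR_iff [Finite E] [hσm : Fact (σK ^ m = 1)] {q : ℕ} (hq : 1 < q)
    (hσq : ∀ x, σK x = x ^ q) (hK : Nat.card K = q ^ m) (hroots : (X ^ ℓ - 1 : E[X]).Splits)
    (hℓ : (ℓ : K) ≠ 0) (hσ : ∀ x, algebraMap F K (σF x) = σK (algebraMap F K x))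
    (hE : ∀ a : E, σK (algebraMap E K a) = algebraMap E K a) (hC : IsCSC σF C)
    {g h : Sz σF ℓ} (hgh : IsMinimalPair σF C g h) (c : RR σF ℓ m) :
    c ∈ codeInR σF C ↔ ∀ (a : E) (β : Kˣ) (ha : a ^ ℓ = 1),
      totalEval σF σK (algebraMap E K a) (map_pow_eq_one ha) β (toQuot m g) = 0 →
        totalEval σF σK (algebraMap E K a) (map_pow_eq_one ha) β c = 0 := by
  have hfin : Finite K := Nat.finite_of_card_ne_zero (by rw [hK]; positivity)
  have hτ := point_sigmaS (ℓ := ℓ) hσ hE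
  have hinj := eq_zero_of_point_eq_zero (F := F) hroots hℓ
  obtain ⟨f, rfl⟩ := Submodule.Quotient.mk_surjective _ c
  rw [← mem_codeIdeal hC, hgh.codeIdeal_eq hC]
  constructor
  · intro hf a β ha h0
    obtain ⟨u, rfl⟩ := Ideal.mem_span_singleton'.mp hf
    rw [totalEval_toQuot_eq_zero_iff] at h0 ⊢
    exact (skewOp_mul (hτ ⟨a, ha⟩) u g β).trans
      ((congrArg (skewOp σK (point F K ⟨a, ha⟩) u) h0).trans (map_zero _))
  · intro hev
    refine mem_span_singleton_of_local hτ hinj fun a => ?_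
    obtain ⟨d, hd⟩ := (isComponentwiseMonic_iff (K := K) hroots (NeZero.ne ℓ)).mp hgh.monic_gen a
    refine ⟨d, hd, fun u hu => ?_⟩
    refine degLT_zero_of_ker_le (hτ a) hq hσq hσm.out hK (NeZero.pos m) hgh.check_mul_gen hd hu
      fun β hβ => ?_
    by_cases hβ0 : β = 0
    · rw [hβ0, map_zero]
    have := hev a (Units.mk0 β hβ0) a.2 (by rwa [totalEval_toQuot_eq_zero_iff])
    rw [totalEval_toQuot_eq_zero_iff] at this
    rw [map_sub, AddMonoidHom.sub_apply, skewOp_mul (hτ a), hβ, map_zero, sub_zero]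
    exact this

end MinimalGenerator

end CSC

end

/-! ### The theorem over finite fields -/

theorem mainTheorem5 {p e s m ℓ : ℕ} [Fact p.Prime] (he : 0 < e) (hs : 0 < s)
    [NeZero m] [NeZero ℓ]
    {F Fq K : Type*} [Field F] [Field Fq] [Field K] [Algebra F K] [Algebra Fq K]
    [CharP F p] [CharP K p]
    [Fact (Nat.card F = p ^ (e * m))] (hFq : Nat.card Fq = p ^ (e * s))
    [Fact (Nat.card K = p ^ (e * s * m))]
    (hroots : (Polynomial.X ^ ℓ - 1 : Polynomial Fq).Splits)
    (hpℓ : ¬ p ∣ ℓ)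
    (C : Submodule F (Fin ℓ → Fin m → F))
    (hC : CSC.IsCSC (iterateFrobenius F p (e * s)) C) :
    (∃! g, ∃ h, CSC.IsMinimalPair (iterateFrobenius F p (e * s)) C g h) ∧
    (∀ c : CSC.RR (iterateFrobenius F p (e * s)) ℓ m,
      c ∈ CSC.codeInR (iterateFrobenius F p (e * s)) C ↔
        ∀ (a : Fq) (β : Kˣ) (ha : a ^ ℓ = 1),
          (a, β) ∈ CSC.definingSet Fq (iterateFrobenius F p (e * s))
              (iterateFrobenius K p (e * s)) C →
            CSC.totalEval (iterateFrobenius F p (e * s)) (iterateFrobenius K p (e * s))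
              (algebraMap Fq K a) (CSC.map_pow_eq_one ha) β c = 0) ∧
    (∀ C' : Submodule F (Fin ℓ → Fin m → F),
      CSC.IsCSC (iterateFrobenius F p (e * s)) C' →
        (C = C' ↔
          CSC.definingSet Fq (iterateFrobenius F p (e * s)) (iterateFrobenius K p (e * s)) C =
          CSC.definingSet Fq (iterateFrobenius F p (e * s)) (iterateFrobenius K p (e * s)) C')) := by
  have hFqfin : Finite Fq := Nat.finite_of_card_ne_zero
    (by rw [hFq]; exact (pow_pos (Fact.out : p.Prime).pos _).ne')
  have hKfin : Finite K := Nat.finite_of_card_ne_zero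
    (by rw [(Fact.out : Nat.card K = p ^ (e * s * m))]; exact (pow_pos (Fact.out : p.Prime).pos _).ne')
  have hℓ : (ℓ : K) ≠ 0 := fun h => hpℓ ((CharP.cast_eq_zero_iff K p ℓ).mp h)
  have hq : 1 < p ^ (e * s) := Nat.one_lt_pow (Nat.mul_pos he hs).ne' (Fact.out : p.Prime).one_lt
  have hσq : ∀ x : K, iterateFrobenius K p (e * s) x = x ^ p ^ (e * s) :=
    iterateFrobenius_def p (e * s)
  have hσ : ∀ x, algebraMap F K (iterateFrobenius F p (e * s) x)
      = iterateFrobenius K p (e * s) (algebraMap F K x) := fun x => by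
    rw [iterateFrobenius_def, iterateFrobenius_def, map_pow]
  have hE : ∀ a : Fq, iterateFrobenius K p (e * s) (algebraMap Fq K a) = algebraMap Fq K a := by
    intro a
    have := Fintype.ofFinite Fq
    rw [hσq, ← map_pow, ← hFq, Nat.card_eq_fintype_card, FiniteField.pow_card]
  have hK : Nat.card K = (p ^ (e * s)) ^ m := by
    rw [(Fact.out : Nat.card K = p ^ (e * s * m)), pow_mul]
  have hpart : ∀ C : Submodule F (Fin ℓ → Fin m → F),
      CSC.IsCSC (iterateFrobenius F p (e * s)) C →
      ∀ c : CSC.RR (iterateFrobenius F p (e * s)) ℓ m,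
      c ∈ CSC.codeInR (iterateFrobenius F p (e * s)) C ↔
        ∀ (a : Fq) (β : Kˣ) (ha : a ^ ℓ = 1),
          (a, β) ∈ CSC.definingSet Fq (iterateFrobenius F p (e * s))
              (iterateFrobenius K p (e * s)) C →
            CSC.totalEval (iterateFrobenius F p (e * s)) (iterateFrobenius K p (e * s))
              (algebraMap Fq K a) (CSC.map_pow_eq_one ha) β c = 0 := by
    intro C hC c
    obtain ⟨k, hk⟩ := CSC.minimalGenerator_spec (CSC.exists_isMinimalPair hroots hℓ hσ hE hC)
    rw [hk.mem_codeInR_iff hq hσq hK hroots hℓ hσ hE hC c]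
    exact forall₃_congr fun a β ha => imp_congr_left ⟨fun h => ⟨ha, h⟩, fun ⟨_, h⟩ => h⟩
  refine ⟨?_, hpart C hC, fun C' hC' => ⟨fun h => h ▸ rfl, fun h => ?_⟩⟩
  · obtain ⟨g, h, hgh⟩ := CSC.exists_isMinimalPair hroots hℓ hσ hE hC
    exact ⟨g, ⟨h, hgh⟩, fun g' ⟨h', hgh'⟩ => hgh'.unique hroots hℓ hσ hE hC hgh⟩
  · have hcode : CSC.codeInR (iterateFrobenius F p (e * s)) C
        = CSC.codeInR (iterateFrobenius F p (e * s)) C' := by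
      ext c
      rw [hpart C hC, hpart C' hC', h]
    exact SetLike.coe_injective
      ((CSC.nu_injective hroots hℓ hσ hE).image_injective hcode)
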